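/- Let $0<q<1$ and let $n\ge 0$ be an integer. **The polynomial algebra.** Let $\mathcal F(x_1,\dots,x_n)$ be the free unital complex $*$-algebra on $x_1,\dots,x_n$. Consider all unital $*$-representations $\pi$ of it by bounded operators on complex Hilbert spaces such that, writing $x_i$ for $\pi(x_i)$, $$x_ix_j=0\ (i<j),\qquad x_i^*x_j=0\ (i\ne j),\qquad x_i^*x_i-q\,x_ix_i^*=(1-q)\,Q_i\ (1\le i\le n),$$ where the projections $Q_n,\dots,Q_0$ and the phases $\alpha_n,\dots,\alpha_1$ are defined recursively by $Q_n=1$ and $Q_{i-1}=Q_i-\alpha_i\alpha_i^*$. Here $x_i=Q_ix_iQ_i$, and $|x_i|=(x_i^*x_i)^{1/2}$ is invertible in the corner with unit $Q_i$; the phase is $\alpha_i=x_i\,|x_i|^{-1}$, with the inverse taken in that corner, so that $x_i=\alpha_i|x_i|$ and $\alpha_i^*\alpha_i=Q_i$. Put $\|a\|_0=\sup_\pi\|\pi(a)\|$ and $J_0=\{a:\|a\|_0=0\}$. The polynomial algebra is $P(B_q^{2n})=\mathcal F(x_1,\dots,x_n)/J_0$, and $C^*(x_1,\dots,x_n)$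 is its completion for the norm induced by $\|\cdot\|_0$. **The quantum ball.** The quantum double suspension of a directed graph with finitely many vertices is obtained by adding one new vertex and one edge from the new vertex to each vertex, including itself. Let $E_n$ be the $n$-fold quantum double suspension of the graph with one vertex $v_0$ and no edges, and let $v_i$ be the vertex added at the $i$-th step. Thus $E_n$ has exactly one edge $e_{ij}$ from $v_i$ to $v_j$ for $0\le j\le i\le n$, $i\neq 0$, and no other edges. Let $C(B_q^{2n})=C^*(E_n)$ be its graph algebra, i.e. the universal $C^*$-algebra generated by projections $P_0,\dots,P_n$ and partial isometries $S_{ij}$ with $$P_iP_j=0\ (i\ne j),\qquad S_{ij}^*S_{ij}=P_j,\qquad P_i=\sum_{j=0}^iS_{ij}S_{ij}^*\ (i\neq 0).$$ **Theorem.** There is a $*$-isomorphism $$\psi\colon C^*(x_1,\dots,x_n)\longrightarrow C^*(E_n)=C(B_q^{2n})$$ such that, for $1\le i\le n$, with $S_i=\sum_{j=0}^iS_{ij}$ and $\lambda_k=\sqrt{1-q^{k+1}}-\sqrt{1-q^k}$, $$\psi(x_i)=z_i:=\sum_{k=0}^\infty\lambda_k\,S_i^{k+1}(S_i^*)^k$$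 (a norm-convergent series). Moreover, the elements $x_1,\dots,x_n$ of $C^*(x_1,\dots,x_n)$ themselves satisfy the relations above, with elements $Q_i$ and phases $\alpha_i$ in $C^*(x_1,\dots,x_n)$, and the inverse $\phi=\psi^{-1}$ satisfies, for $1\le i,j\le n$, $$\phi(S_i)=\alpha_i,\quad \phi(P_j)=\alpha_j\alpha_j^*,\quad \phi(P_0)=\alpha_1^*\alpha_1-\alpha_1\alpha_1^*,$$ $$\phi(S_{ij})=\alpha_i\alpha_j\alpha_j^*\ (j\le i),\quad \phi(S_{i0})=\alpha_i(\alpha_1^*\alpha_1-\alpha_1\alpha_1^*).$$ (The formulas that involve $\alpha_1$ are for $n\ge1$.) -/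

import Mathlib

/-! ### The free unital `*`-algebra on a set of generators -/

/-- The free unital `*`-algebra over `ℂ` on `X`: noncommutative polynomials in the letters
`x` (`Sum.inl x`) and `x^*` (`Sum.inr x`). -/
def FreeStarAlgebra (X : Type) : Type := FreeAlgebra ℂ (X ⊕ X)

namespace FreeStarAlgebra

variable {X : Type}

noncomputable instance instRing : Ring (FreeStarAlgebra X) :=
  inferInstanceAs (Ring (FreeAlgebra ℂ (X ⊕ X)))

noncomputable instance instAlgebra : Algebra ℂ (FreeStarAlgebra X) :=
  inferInstanceAs (Algebra ℂ (FreeAlgebra ℂ (X ⊕ X)))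

/-- The letter `x` or `x^*`. -/
noncomputable def letter (s : X ⊕ X) : FreeStarAlgebra X := FreeAlgebra.ι ℂ s

/-- The generator `x`. -/
noncomputable def gen (x : X) : FreeStarAlgebra X := letter (Sum.inl x)

theorem induction {C : FreeStarAlgebra X → Prop}
    (h_scalar : ∀ c : ℂ, C (algebraMap ℂ (FreeStarAlgebra X) c))
    (h_letter : ∀ s, C (letter s))
    (h_mul : ∀ a b, C a → C b → C (a * b))
    (h_add : ∀ a b, C a → C b → C (a + b)) (a : FreeStarAlgebra X) : C a :=
  FreeAlgebra.induction (R := ℂ) (X := X ⊕ X) (motive := C) h_scalar h_letter h_mul h_add a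

/-- The opposite algebra, with the conjugate scalar action. -/
noncomputable abbrev conjOpAlgebra : Algebra ℂ (FreeStarAlgebra X)ᵐᵒᵖ :=
  ((algebraMap ℂ (FreeStarAlgebra X)ᵐᵒᵖ).comp (starRingEnd ℂ)).toAlgebra'
    (fun c a => Algebra.commutes (R := ℂ) (starRingEnd ℂ c) a)

/-- The involution as a ring homomorphism into the opposite ring: it interchanges `x` and `x^*`
and conjugates the scalars. -/
noncomputable def involution : FreeStarAlgebra X →+* (FreeStarAlgebra X)ᵐᵒᵖ :=
  letI := conjOpAlgebra (X := X)
  (FreeAlgebra.lift ℂ (A := (FreeStarAlgebra X)ᵐᵒᵖ)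
    (fun s : X ⊕ X => MulOpposite.op (letter s.swap)) :
      FreeAlgebra ℂ (X ⊕ X) →ₐ[ℂ] (FreeStarAlgebra X)ᵐᵒᵖ).toRingHom

theorem involution_letter (s : X ⊕ X) :
    involution (letter s) = MulOpposite.op (letter s.swap) := by
  let := conjOpAlgebra (X := X)
  exact FreeAlgebra.lift_ι_apply (R := ℂ) (A := (FreeStarAlgebra X)ᵐᵒᵖ) _ s

theorem involution_scalar (c : ℂ) :
    involution (algebraMap ℂ (FreeStarAlgebra X) c)
      = MulOpposite.op (algebraMap ℂ (FreeStarAlgebra X) (starRingEnd ℂ c)) := by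
  let := conjOpAlgebra (X := X)
  exact AlgHom.commutes (FreeAlgebra.lift ℂ (A := (FreeStarAlgebra X)ᵐᵒᵖ)
    (fun s : X ⊕ X => MulOpposite.op (letter s.swap)) :
      FreeAlgebra ℂ (X ⊕ X) →ₐ[ℂ] (FreeStarAlgebra X)ᵐᵒᵖ) c

noncomputable instance instStar : Star (FreeStarAlgebra X) where
  star a := (involution a).unop

theorem star_def (a : FreeStarAlgebra X) : star a = (involution a).unop := rfl

theorem star_letter (s : X ⊕ X) : star (letter s) = letter s.swap := by
  rw [star_def, involution_letter, MulOpposite.unop_op]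

theorem star_scalar (c : ℂ) : star (algebraMap ℂ (FreeStarAlgebra X) c)
    = algebraMap ℂ (FreeStarAlgebra X) (starRingEnd ℂ c) := by
  rw [star_def, involution_scalar, MulOpposite.unop_op]

theorem star_mul_aux (a b : FreeStarAlgebra X) : star (a * b) = star b * star a := by
  rw [star_def, map_mul, MulOpposite.unop_mul]; rfl

theorem star_add_aux (a b : FreeStarAlgebra X) : star (a + b) = star a + star b := by
  rw [star_def, map_add, MulOpposite.unop_add]; rfl

noncomputable instance instStarRing : StarRing (FreeStarAlgebra X) where
  star_involutive a := by
    induction a using induction with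
    | h_scalar c => rw [star_scalar, star_scalar, Complex.conj_conj]
    | h_letter s => rw [star_letter, star_letter, Sum.swap_swap]
    | h_mul a b ha hb => rw [star_mul_aux, star_mul_aux, ha, hb]
    | h_add a b ha hb => rw [star_add_aux, star_add_aux, ha, hb]
  star_mul := star_mul_aux
  star_add := star_add_aux

instance instStarModule : StarModule ℂ (FreeStarAlgebra X) where
  star_smul c a := by
    rw [Algebra.smul_def, star_mul_aux, star_scalar, ← Algebra.commutes, ← Algebra.smul_def]
    rfl

section lift

variable {A : Type*} [Ring A] [StarRing A] [Algebra ℂ A]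

/-- The underlying algebra homomorphism of the representation determined by `x ↦ T x`. -/
noncomputable def liftAlg (T : X → A) : FreeStarAlgebra X →ₐ[ℂ] A :=
  (FreeAlgebra.lift ℂ (Sum.elim T fun x => star (T x)) : FreeAlgebra ℂ (X ⊕ X) →ₐ[ℂ] A)

theorem liftAlg_letter (T : X → A) (s : X ⊕ X) :
    liftAlg T (letter s) = Sum.elim T (fun x => star (T x)) s :=
  FreeAlgebra.lift_ι_apply (R := ℂ) _ s

variable [StarModule ℂ A]

/-- The unital `*`-homomorphism determined by `x ↦ T x`. -/
noncomputable def lift (T : X → A) : FreeStarAlgebra X →⋆ₐ[ℂ] A where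
  __ := liftAlg T
  map_star' a := by
    change liftAlg T (star a) = star (liftAlg T a)
    induction a using induction with
    | h_scalar c =>
      rw [star_scalar, AlgHom.commutes, AlgHom.commutes]; exact algebraMap_star_comm c
    | h_letter s => rw [star_letter, liftAlg_letter, liftAlg_letter]; cases s <;> simp
    | h_mul a b ha hb => rw [star_mul, map_mul, map_mul, ha, hb, star_mul]
    | h_add a b ha hb => rw [star_add, map_add, map_add, ha, hb, star_add]

theorem lift_letter (T : X → A) (s : X ⊕ X) :
    lift T (letter s) = Sum.elim T (fun x => star (T x)) s :=
  liftAlg_letter T s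

theorem lift_gen (T : X → A) (x : X) : lift T (gen x) = T x :=
  lift_letter T (Sum.inl x)

end lift

end FreeStarAlgebra

/-! ### Universal `C^*`-algebras -/

/-- Relations on a set `X` of generators: they single out, on every complex Hilbert space `H`, the
families of bounded operators `(T_x)_{x ∈ X}` that satisfy them, and they bound the norm of every
generator. -/
structure OperatorRelations (X : Type) where
  Holds : ∀ (H : Type) [NormedAddCommGroup H] [InnerProductSpace ℂ H] [CompleteSpace H],
    (X → H →L[ℂ] H) → Prop
  bounded : ∀ x : X, ∃ C : ℝ,
    ∀ (H : Type) [NormedAddCommGroup H] [InnerProductSpace ℂ H] [CompleteSpace H]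
      (T : X → H →L[ℂ] H), Holds H T → ‖T x‖ ≤ C

namespace OperatorRelations

variable {X : Type} (R : OperatorRelations X)

/-- The set of the numbers `‖π(a)‖`, where `π` runs over all representations of the free
`*`-algebra on Hilbert spaces whose generators satisfy the relations. -/
def normValues (a : FreeStarAlgebra X) : Set ℝ :=
  {t | ∃ (H : Type) (_ : NormedAddCommGroup H) (_ : InnerProductSpace ℂ H) (_ : CompleteSpace H)
    (T : X → H →L[ℂ] H), R.Holds H T ∧ t = ‖FreeStarAlgebra.lift T a‖}

/-- `‖a‖₀ = sup_π ‖π(a)‖`. -/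
noncomputable def supNorm (a : FreeStarAlgebra X) : ℝ := sSup (R.normValues a)

theorem exists_bound (a : FreeStarAlgebra X) : ∃ C : ℝ, ∀ t ∈ R.normValues a, t ≤ C := by
  induction a using FreeStarAlgebra.induction with
  | h_scalar c =>
    refine ⟨‖c‖, ?_⟩
    rintro _ ⟨H, _, _, _, T, -, rfl⟩
    rw [AlgHomClass.commutes, Algebra.algebraMap_eq_smul_one, norm_smul]
    exact mul_le_of_le_one_right (norm_nonneg c) ContinuousLinearMap.norm_id_le
  | h_letter s =>
    obtain ⟨C, hC⟩ := R.bounded (s.elim id id)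
    refine ⟨C, ?_⟩
    rintro _ ⟨H, _, _, _, T, hT, rfl⟩
    rw [FreeStarAlgebra.lift_letter]
    cases s with
    | inl x => exact hC H T hT
    | inr x => simpa using hC H T hT
  | h_mul a b ha hb =>
    obtain ⟨C, hC⟩ := ha
    obtain ⟨D, hD⟩ := hb
    refine ⟨|C| * |D|, ?_⟩
    rintro _ ⟨H, _, _, _, T, hT, rfl⟩
    rw [map_mul]
    exact (norm_mul_le _ _).trans (mul_le_mul
      ((hC _ ⟨H, _, _, _, T, hT, rfl⟩).trans (le_abs_self C))
      ((hD _ ⟨H, _, _, _, T, hT, rfl⟩).trans (le_abs_self D)) (norm_nonneg _) (abs_nonneg _))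
  | h_add a b ha hb =>
    obtain ⟨C, hC⟩ := ha
    obtain ⟨D, hD⟩ := hb
    refine ⟨C + D, ?_⟩
    rintro _ ⟨H, _, _, _, T, hT, rfl⟩
    rw [map_add]
    exact (norm_add_le _ _).trans (add_le_add
      (hC _ ⟨H, _, _, _, T, hT, rfl⟩) (hD _ ⟨H, _, _, _, T, hT, rfl⟩))

theorem le_supNorm {a : FreeStarAlgebra X} {t : ℝ} (h : t ∈ R.normValues a) : t ≤ R.supNorm a :=
  le_csSup (R.exists_bound a) h

theorem supNorm_nonneg (a : FreeStarAlgebra X) : 0 ≤ R.supNorm a := by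
  refine Real.sSup_nonneg ?_
  rintro _ ⟨H, _, _, _, T, -, rfl⟩
  exact norm_nonneg _

theorem supNorm_le {a : FreeStarAlgebra X} {C : ℝ} (hC : 0 ≤ C)
    (h : ∀ t ∈ R.normValues a, t ≤ C) : R.supNorm a ≤ C :=
  Real.sSup_le h hC

theorem supNorm_zero : R.supNorm 0 = 0 := by
  refine le_antisymm (R.supNorm_le le_rfl ?_) (R.supNorm_nonneg 0)
  rintro _ ⟨H, _, _, _, T, -, rfl⟩
  simp

theorem supNorm_add (a b : FreeStarAlgebra X) :
    R.supNorm (a + b) ≤ R.supNorm a + R.supNorm b := by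
  refine R.supNorm_le (add_nonneg (R.supNorm_nonneg a) (R.supNorm_nonneg b)) ?_
  rintro _ ⟨H, _, _, _, T, hT, rfl⟩
  rw [map_add]
  exact (norm_add_le _ _).trans (add_le_add
    (R.le_supNorm ⟨H, _, _, _, T, hT, rfl⟩) (R.le_supNorm ⟨H, _, _, _, T, hT, rfl⟩))

theorem supNorm_neg (a : FreeStarAlgebra X) : R.supNorm (-a) = R.supNorm a := by
  unfold supNorm normValues
  simp only [map_neg, norm_neg]

theorem supNorm_mul (a b : FreeStarAlgebra X) :
    R.supNorm (a * b) ≤ R.supNorm a * R.supNorm b := by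
  refine R.supNorm_le (mul_nonneg (R.supNorm_nonneg a) (R.supNorm_nonneg b)) ?_
  rintro _ ⟨H, _, _, _, T, hT, rfl⟩
  rw [map_mul]
  exact (norm_mul_le _ _).trans (mul_le_mul
    (R.le_supNorm ⟨H, _, _, _, T, hT, rfl⟩) (R.le_supNorm ⟨H, _, _, _, T, hT, rfl⟩)
    (norm_nonneg _) (R.supNorm_nonneg a))

theorem supNorm_smul (c : ℂ) (a : FreeStarAlgebra X) :
    R.supNorm (c • a) ≤ ‖c‖ * R.supNorm a := by
  refine R.supNorm_le (mul_nonneg (norm_nonneg c) (R.supNorm_nonneg a)) ?_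
  rintro _ ⟨H, _, _, _, T, hT, rfl⟩
  rw [map_smul, norm_smul]
  exact mul_le_mul_of_nonneg_left (R.le_supNorm ⟨H, _, _, _, T, hT, rfl⟩) (norm_nonneg c)

theorem supNorm_star (a : FreeStarAlgebra X) : R.supNorm (star a) = R.supNorm a := by
  unfold supNorm normValues
  simp only [map_star, norm_star]

theorem supNorm_star_mul_self (a : FreeStarAlgebra X) :
    R.supNorm a * R.supNorm a ≤ R.supNorm (star a * a) := by
  have h : R.supNorm a ≤ Real.sqrt (R.supNorm (star a * a)) := by
    refine R.supNorm_le (Real.sqrt_nonneg _) ?_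
    rintro _ ⟨H, _, _, _, T, hT, rfl⟩
    refine Real.le_sqrt_of_sq_le ?_
    rw [pow_two, ← CStarRing.norm_star_mul_self, ← map_star, ← map_mul]
    exact R.le_supNorm ⟨H, _, _, _, T, hT, rfl⟩
  calc R.supNorm a * R.supNorm a
      ≤ Real.sqrt (R.supNorm (star a * a)) * Real.sqrt (R.supNorm (star a * a)) :=
        mul_self_le_mul_self (R.supNorm_nonneg a) h
    _ = R.supNorm (star a * a) := Real.mul_self_sqrt (R.supNorm_nonneg _)

/-- The free `*`-algebra, equipped with the seminorm `‖·‖₀`. -/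
def Seminormed (_R : OperatorRelations X) : Type := FreeStarAlgebra X

noncomputable instance : Ring R.Seminormed := inferInstanceAs (Ring (FreeStarAlgebra X))

noncomputable instance : Algebra ℂ R.Seminormed := inferInstanceAs (Algebra ℂ (FreeStarAlgebra X))

noncomputable instance : StarRing R.Seminormed := inferInstanceAs (StarRing (FreeStarAlgebra X))

instance : StarModule ℂ R.Seminormed := inferInstanceAs (StarModule ℂ (FreeStarAlgebra X))

noncomputable instance instSeminormedRing : SeminormedRing R.Seminormed :=
  { (inferInstance : Ring R.Seminormed),
    AddGroupSeminorm.toSeminormedAddCommGroup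
      (E := R.Seminormed)
      { toFun := R.supNorm
        map_zero' := R.supNorm_zero
        add_le' := R.supNorm_add
        neg' := R.supNorm_neg } with
    norm_mul_le := R.supNorm_mul }

/-- A polynomial, as an element of the seminormed algebra. -/
def Seminormed.of (a : FreeStarAlgebra X) : R.Seminormed := a

theorem Seminormed.norm_of (a : FreeStarAlgebra X) : ‖Seminormed.of R a‖ = R.supNorm a := rfl

noncomputable instance : NormedAlgebra ℂ R.Seminormed where
  norm_smul_le := R.supNorm_smul

instance : NormedStarGroup R.Seminormed where
  norm_star_le a := (R.supNorm_star a).le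

/-- The quotient `*`-algebra of the free `*`-algebra by the ideal `J₀ = {a : ‖a‖₀ = 0}`, with the
norm induced by `‖·‖₀`. -/
def Quot₀ : Type := SeparationQuotient R.Seminormed

noncomputable instance instQuotNormedRing : NormedRing R.Quot₀ :=
  inferInstanceAs (NormedRing (SeparationQuotient R.Seminormed))

noncomputable instance instQuotNormedAlgebra : NormedAlgebra ℂ R.Quot₀ :=
  inferInstanceAs (NormedAlgebra ℂ (SeparationQuotient R.Seminormed))

/-- The class of a polynomial modulo `J₀`. -/
noncomputable def Quot₀.mk (a : R.Seminormed) : R.Quot₀ := SeparationQuotient.mk a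

theorem Quot₀.mk_surjective : Function.Surjective (Quot₀.mk R) :=
  SeparationQuotient.surjective_mk

theorem Quot₀.norm_mk (a : R.Seminormed) : ‖Quot₀.mk R a‖ = ‖a‖ := rfl

/-- Two polynomials have the same class exactly when their difference lies in `J₀`. -/
theorem Quot₀.mk_eq_mk (a b : R.Seminormed) :
    Quot₀.mk R a = Quot₀.mk R b ↔ ‖a - b‖ = 0 :=
  SeparationQuotient.mk_eq_mk.trans
    (Metric.inseparable_iff.trans (by rw [dist_eq_norm]))

theorem Quot₀.mk_mul (a b : R.Seminormed) :
    Quot₀.mk R (a * b) = Quot₀.mk R a * Quot₀.mk R b := rfl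

theorem Quot₀.mk_add (a b : R.Seminormed) :
    Quot₀.mk R (a + b) = Quot₀.mk R a + Quot₀.mk R b := rfl

theorem Quot₀.mk_smul (c : ℂ) (a : R.Seminormed) :
    Quot₀.mk R (c • a) = c • Quot₀.mk R a := rfl

noncomputable instance instQuotStar : Star R.Quot₀ where
  star := SeparationQuotient.lift (fun a : R.Seminormed => Quot₀.mk R (star a)) (by
    intro a b h
    have h' : Quot₀.mk R a = Quot₀.mk R b := SeparationQuotient.mk_eq_mk.2 h
    rw [Quot₀.mk_eq_mk] at h'
    rw [Quot₀.mk_eq_mk, ← star_sub, norm_star, h'])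

theorem Quot₀.star_mk (a : R.Seminormed) :
    star (Quot₀.mk R a) = Quot₀.mk R (star a) := rfl

noncomputable instance instQuotStarRing : StarRing R.Quot₀ where
  star_involutive a := by
    obtain ⟨a, rfl⟩ := Quot₀.mk_surjective R a
    rw [Quot₀.star_mk, Quot₀.star_mk, star_star]
  star_mul a b := by
    obtain ⟨a, rfl⟩ := Quot₀.mk_surjective R a
    obtain ⟨b, rfl⟩ := Quot₀.mk_surjective R b
    rw [← Quot₀.mk_mul, Quot₀.star_mk, star_mul]; rfl
  star_add a b := by
    obtain ⟨a, rfl⟩ := Quot₀.mk_surjective R a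
    obtain ⟨b, rfl⟩ := Quot₀.mk_surjective R b
    rw [← Quot₀.mk_add, Quot₀.star_mk, star_add]; rfl

instance instQuotStarModule : StarModule ℂ R.Quot₀ where
  star_smul c a := by
    obtain ⟨a, rfl⟩ := Quot₀.mk_surjective R a
    rw [← Quot₀.mk_smul, Quot₀.star_mk, star_smul]; rfl

instance instQuotCStarRing : CStarRing R.Quot₀ where
  norm_mul_self_le a := by
    obtain ⟨a, rfl⟩ := Quot₀.mk_surjective R a
    exact R.supNorm_star_mul_self a

end OperatorRelations

/-! ### The completion of a normed `*`-algebra with a `C^*`-norm -/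

section Completion

open UniformSpace

variable {A : Type*} [NormedRing A] [StarRing A]

noncomputable instance instStarCompletion : Star (Completion A) where
  star := Completion.map star

theorem Completion.continuous_star_aux : Continuous (star : Completion A → Completion A) :=
  Completion.continuous_map

variable [CStarRing A]

theorem Completion.star_coe (a : A) : star (a : Completion A) = ((star a : A) : Completion A) :=
  Completion.map_coe (starNormedAddGroupHom : NormedAddGroupHom A A).uniformContinuous a

noncomputable instance instStarRingCompletion : StarRing (Completion A) where
  star_involutive a := by
    induction a using Completion.induction_on with
    | hp =>
      exact isClosed_eq
        (Completion.continuous_star_aux.comp Completion.continuous_star_aux) continuous_id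
    | ih a => rw [Completion.star_coe, Completion.star_coe, star_star]
  star_mul a b := by
    induction a, b using Completion.induction_on₂ with
    | hp =>
      exact isClosed_eq (Completion.continuous_star_aux.comp (continuous_fst.mul continuous_snd))
        ((Completion.continuous_star_aux.comp continuous_snd).mul
          (Completion.continuous_star_aux.comp continuous_fst))
    | ih a b =>
      rw [← Completion.coe_mul, Completion.star_coe, Completion.star_coe, Completion.star_coe,
        star_mul, Completion.coe_mul]
  star_add a b := by
    induction a, b using Completion.induction_on₂ with
    | hp =>
      exact isClosed_eq (Completion.continuous_star_aux.comp (continuous_fst.add continuous_snd))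
        ((Completion.continuous_star_aux.comp continuous_fst).add
          (Completion.continuous_star_aux.comp continuous_snd))
    | ih a b =>
      rw [← Completion.coe_add, Completion.star_coe, Completion.star_coe, Completion.star_coe,
        star_add, Completion.coe_add]

instance instCStarRingCompletion : CStarRing (Completion A) where
  norm_mul_self_le a := by
    induction a using Completion.induction_on with
    | hp =>
      exact isClosed_le (continuous_norm.mul continuous_norm)
        (continuous_norm.comp (Completion.continuous_star_aux.mul continuous_id))
    | ih a =>
      rw [Completion.star_coe, ← Completion.coe_mul, Completion.norm_coe, Completion.norm_coe]
      exact CStarRing.norm_mul_self_le a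

variable [NormedAlgebra ℂ A]

noncomputable instance instNormedAlgebraCompletion : NormedAlgebra ℂ (Completion A) where
  norm_smul_le := norm_smul_le

instance instStarModuleCompletion [StarModule ℂ A] : StarModule ℂ (Completion A) where
  star_smul c a := by
    induction a using Completion.induction_on with
    | hp =>
      exact isClosed_eq (Completion.continuous_star_aux.comp (continuous_const_smul c))
        ((continuous_const_smul (star c)).comp Completion.continuous_star_aux)
    | ih a =>
      rw [← Completion.coe_smul, Completion.star_coe, star_smul, Completion.coe_smul,
        Completion.star_coe]

noncomputable instance instCStarAlgebraCompletion [StarModule ℂ A] :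
    CStarAlgebra (Completion A) where

end Completion

namespace OperatorRelations

variable {X : Type} (R : OperatorRelations X)

/-- The universal unital `C^*`-algebra of the relations: the completion of the quotient of the free
`*`-algebra by `J₀`. -/
abbrev UniversalCStar : Type := UniformSpace.Completion R.Quot₀

/-- The canonical generators of the universal `C^*`-algebra. -/
noncomputable def ugen (x : X) : R.UniversalCStar :=
  ((Quot₀.mk R (Seminormed.of R (FreeStarAlgebra.gen x)) : R.Quot₀) : UniformSpace.Completion R.Quot₀)

end OperatorRelations

/-! ### Directed graphs and graph `C^*`-algebras -/

/-- A directed graph with countably many vertices and edges (loops and multiple edges allowed). -/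
structure DirectedGraph where
  Vert : Type
  Edge : Type
  range : Edge → Vert
  source : Edge → Vert
  countable_vert : Countable Vert
  countable_edge : Countable Edge

namespace DirectedGraph

/-- Every vertex emits at most finitely many edges. -/
def RowFinite (E : DirectedGraph) : Prop := ∀ v, {e : E.Edge | E.source e = v}.Finite

/-- The finite set of the edges emitted by `v`. -/
noncomputable def RowFinite.out {E : DirectedGraph} (hE : E.RowFinite) (v : E.Vert) :
    Finset E.Edge := (hE v).toFinset

/-- Cuntz-Krieger `E`-families. The `S e` are partial isometries because `S_e^* S_e` is a
projection. -/
structure IsCuntzKriegerFamily {E : DirectedGraph} (hE : E.RowFinite) {A : Type*} [Ring A]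
    [StarRing A] (P : E.Vert → A) (S : E.Edge → A) : Prop where
  proj : ∀ v, IsStarProjection (P v)
  orthogonal : ∀ v w, v ≠ w → P v * P w = 0
  star_mul_self : ∀ e, star (S e) * S e = P (E.range e)
  cuntz_krieger : ∀ v, (∃ e, E.source e = v) → P v = ∑ e ∈ hE.out v, S e * star (S e)

/-- The Cuntz-Krieger relations; the generators are the `P v` (`Sum.inl v`) and the `S e`
(`Sum.inr e`). -/
def cuntzKrieger {E : DirectedGraph} (hE : E.RowFinite) : OperatorRelations (E.Vert ⊕ E.Edge) where
  Holds _ _ _ _ T := IsCuntzKriegerFamily hE (fun v => T (Sum.inl v)) (fun e => T (Sum.inr e))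
  bounded x := by
    refine ⟨1, ?_⟩
    intro H _ _ _ T hT
    cases x with
    | inl v => exact (hT.proj v).norm_le
    | inr e =>
      have h := (hT.proj (E.range e)).norm_le
      rw [← hT.star_mul_self e, CStarRing.norm_star_mul_self] at h
      nlinarith [norm_nonneg (T (Sum.inr e))]

/-- The graph algebra `C^*(E)` of a row-finite graph: the (not necessarily unital) `C^*`-algebra
generated by the universal Cuntz-Krieger `E`-family. -/
noncomputable def graphCStar {E : DirectedGraph} (hE : E.RowFinite) :
    NonUnitalStarSubalgebra ℂ (cuntzKrieger hE).UniversalCStar :=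
  (NonUnitalStarAlgebra.adjoin ℂ (Set.range (cuntzKrieger hE).ugen)).topologicalClosure

theorem ugen_mem {E : DirectedGraph} (hE : E.RowFinite) (x : E.Vert ⊕ E.Edge) :
    (cuntzKrieger hE).ugen x ∈ graphCStar hE :=
  NonUnitalStarSubalgebra.le_topologicalClosure _
    (NonUnitalStarAlgebra.subset_adjoin ℂ _ ⟨x, rfl⟩)

/-- The universal projection `P_v`. -/
noncomputable def projP {E : DirectedGraph} (hE : E.RowFinite) (v : E.Vert) : graphCStar hE :=
  ⟨(cuntzKrieger hE).ugen (Sum.inl v), ugen_mem hE _⟩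

/-- The universal partial isometry `S_e`. -/
noncomputable def isomS {E : DirectedGraph} (hE : E.RowFinite) (e : E.Edge) : graphCStar hE :=
  ⟨(cuntzKrieger hE).ugen (Sum.inr e), ugen_mem hE _⟩

/-- The graph with one vertex and no edges. -/
def singleVertex : DirectedGraph where
  Vert := Unit
  Edge := Empty
  range := Empty.elim
  source := Empty.elim
  countable_vert := inferInstance
  countable_edge := inferInstance

/-- The quantum double suspension: a new vertex (`none`) is added, together with one edge from
the new vertex to every vertex, including itself. -/
def doubleSuspension (E : DirectedGraph) : DirectedGraph where
  Vert := Option E.Vert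
  Edge := E.Edge ⊕ Option E.Vert
  range := Sum.elim (fun e => some (E.range e)) id
  source := Sum.elim (fun e => some (E.source e)) (fun _ => none)
  countable_vert := by
    have := E.countable_vert
    infer_instance
  countable_edge := by
    have := E.countable_vert
    have := E.countable_edge
    infer_instance

end DirectedGraph

/-- The graph `E_n`: the `n`-fold quantum double suspension of the one-vertex graph. -/
def ballGraph : ℕ → DirectedGraph
  | 0 => DirectedGraph.singleVertex
  | n + 1 => (ballGraph n).doubleSuspension

/-- The vertices `v_0, …, v_n` of `E_n`: `v_n` is the vertex added in the last suspension. -/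
def ballVertex : (n : ℕ) → Fin (n + 1) → (ballGraph n).Vert
  | 0 => fun _ => ()
  | n + 1 => Fin.lastCases (motive := fun _ => Option (ballGraph n).Vert) none
      (fun i => some (ballVertex n i))

theorem ballGraph_finite (n : ℕ) : Finite (ballGraph n).Vert ∧ Finite (ballGraph n).Edge := by
  induction n with
  | zero => exact ⟨inferInstanceAs (Finite Unit), inferInstanceAs (Finite Empty)⟩
  | succ n ih =>
    obtain ⟨h1, h2⟩ := ih
    exact ⟨inferInstanceAs (Finite (Option (ballGraph n).Vert)),
      inferInstanceAs (Finite ((ballGraph n).Edge ⊕ Option (ballGraph n).Vert))⟩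

theorem ballGraph_rowFinite (n : ℕ) : (ballGraph n).RowFinite := fun _ =>
  have := (ballGraph_finite n).2
  Set.toFinite _

/-! ### The quantum even-dimensional balls -/

namespace QuantumBall

/-- The modulus `|x| = (x^* x)^{1/2}`. -/
noncomputable def modulus {A : Type*} [CStarAlgebra A] (x : A) : A :=
  cfc (fun t : ℝ => Real.sqrt t) (star x * x)

/-- `α` is the phase of `x` relative to the corner `pAp`: `p` is a projection, `x ∈ pAp`, `|x|` is
invertible in the unital algebra `pAp` (with inverse `b`), and `α = x b`. -/
def IsCornerPhase {A : Type*} [CStarAlgebra A] (p x α : A) : Prop :=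
  IsStarProjection p ∧ p * x * p = x ∧
    ∃ b : A, p * b * p = b ∧ b * modulus x = p ∧ modulus x * b = p ∧ α = x * b

/-- The defining relations of the quantum `2n`-ball, for `x_1, …, x_n` (with `x i` standing for
`x_{i+1}`), together with the elements `Q_0, …, Q_n` and the phases `α_1, …, α_n`. These are
determined recursively by `x`: `Q_n = 1`, and once the relation for `x_i` holds, `x_i` lies in the
corner of `Q_i`, `|x_i|` is automatically invertible there, `α_i` is the phase of `x_i`, and
`Q_{i-1} = Q_i - α_i α_i^*`. -/
structure IsBallSystem {A : Type*} [CStarAlgebra A] {n : ℕ} (q : ℝ) (x : Fin n → A)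
    (Q : Fin (n + 1) → A) (α : Fin n → A) : Prop where
  mul_eq_zero : ∀ i j, i < j → x i * x j = 0
  star_mul_eq_zero : ∀ i j, i ≠ j → star (x i) * x j = 0
  top : Q (Fin.last n) = 1
  phase : ∀ i : Fin n, IsCornerPhase (Q i.succ) (x i) (α i)
  step : ∀ i : Fin n, Q i.castSucc = Q i.succ - α i * star (α i)
  qrel : ∀ i : Fin n,
    star (x i) * x i - (q : ℂ) • (x i * star (x i)) = ((1 - q : ℝ) : ℂ) • Q i.succ

theorem IsBallSystem.norm_le_one {A : Type*} [CStarAlgebra A] {n : ℕ} {q : ℝ} (hq0 : 0 < q)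
    (hq1 : q < 1) {x : Fin n → A} {Q : Fin (n + 1) → A} {α : Fin n → A}
    (h : IsBallSystem q x Q α) (i : Fin n) : ‖x i‖ ≤ 1 := by
  have hQ : ‖Q i.succ‖ ≤ 1 := (h.phase i).1.norm_le
  have h1 : star (x i) * x i
      = (q : ℂ) • (x i * star (x i)) + ((1 - q : ℝ) : ℂ) • Q i.succ := by
    rw [← h.qrel i]; abel
  have h2 : ‖x i‖ * ‖x i‖ ≤ q * (‖x i‖ * ‖x i‖) + (1 - q) * 1 := by
    rw [← CStarRing.norm_star_mul_self, h1]
    refine (norm_add_le _ _).trans (add_le_add ?_ ?_)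
    · rw [norm_smul, CStarRing.norm_self_mul_star, ← h1, CStarRing.norm_star_mul_self,
        Complex.norm_real, Real.norm_of_nonneg hq0.le]
    · rw [norm_smul, Complex.norm_real, Real.norm_of_nonneg (by linarith)]
      exact mul_le_mul_of_nonneg_left hQ (by linarith)
  have h3 : ‖x i‖ * ‖x i‖ ≤ 1 := by
    by_contra hlt
    nlinarith [mul_pos (sub_pos.2 hq1) (sub_pos.2 (not_le.1 hlt))]
  nlinarith [norm_nonneg (x i)]

/-- The relations that define the polynomial algebra of the quantum `2n`-ball. -/
def ballRelations (n : ℕ) (q : ℝ) (hq0 : 0 < q) (hq1 : q < 1) : OperatorRelations (Fin n) where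
  Holds _ _ _ _ T := ∃ Q α, IsBallSystem q T Q α
  bounded i := ⟨1, fun _ _ _ _ _ ⟨_, _, h⟩ => h.norm_le_one hq0 hq1 i⟩

/-- The polynomial algebra `P(B_q^{2n})`. -/
abbrev PolyAlgebra (n : ℕ) (q : ℝ) (hq0 : 0 < q) (hq1 : q < 1) : Type :=
  (ballRelations n q hq0 hq1).Quot₀

/-- `C^*(x_1, …, x_n)`, the `C^*`-completion of the polynomial algebra. -/
abbrev PolyCStar (n : ℕ) (q : ℝ) (hq0 : 0 < q) (hq1 : q < 1) : Type :=
  UniformSpace.Completion (PolyAlgebra n q hq0 hq1)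

/-- The generators of `C^*(x_1, …, x_n)`; `xgen … i` is `x_{i+1}`. -/
noncomputable def xgen {n : ℕ} {q : ℝ} (hq0 : 0 < q) (hq1 : q < 1) (i : Fin n) :
    PolyCStar n q hq0 hq1 :=
  (ballRelations n q hq0 hq1).ugen i

/-- The quantum `2n`-ball `C(B_q^{2n}) = C^*(E_n)`. -/
noncomputable abbrev ballCStar (n : ℕ) :
    NonUnitalStarSubalgebra ℂ (DirectedGraph.cuntzKrieger (ballGraph_rowFinite n)).UniversalCStar :=
  DirectedGraph.graphCStar (ballGraph_rowFinite n)

/-- The projection `P_j ∈ C^*(E_n)` at the vertex `v_j`. -/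
noncomputable def ballP {n : ℕ} (j : Fin (n + 1)) : ballCStar n :=
  DirectedGraph.projP (ballGraph_rowFinite n) (ballVertex n j)

/-- The partial isometry `S_e ∈ C^*(E_n)` of an edge. -/
noncomputable def ballS {n : ℕ} (e : (ballGraph n).Edge) : ballCStar n :=
  DirectedGraph.isomS (ballGraph_rowFinite n) e

/-- `S_{i+1} ∈ C^*(E_n)`, the sum of the `S_e` over all edges `e` emitted by `v_{i+1}`. -/
noncomputable def ballSum {n : ℕ} (i : Fin n) : ballCStar n :=
  ∑ e ∈ (ballGraph_rowFinite n).out (ballVertex n i.succ), ballS e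

/-- `λ_k = √(1 - q^{k+1}) - √(1 - q^k)`. -/
noncomputable def coeff (q : ℝ) (k : ℕ) : ℝ := Real.sqrt (1 - q ^ (k + 1)) - Real.sqrt (1 - q ^ k)

end QuantumBall

/-! ### Maps out of universal `C^*`-algebras -/

namespace FreeStarAlgebra

variable {X : Type} {A : Type*} [Ring A] [StarRing A] [Algebra ℂ A]

/-! Each `x_i` is determined by its phase, and the phases of all the `x_i` together are the same
data as a Cuntz-Krieger family of `E_n` whose vertex projections sum to `1`.

One generator. Let `s` be the phase of `x`, with `s^* s = Q` and `Q s = s`. Since `x = s|x|`, the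
`q`-relation says that `y = x^* x` solves `y = (1-q) Q + q s y s^*`. The right side is a contraction
in `y`, so `y = ∑ (1-q) q^k e_k` with `e_0 = Q`, `e_{k+1} = s e_k s^*`. The `e_k` are decreasing
projections and the `λ_k` telescope to `√(1 - q^N)`, so the positive square root of `y` is `∑ λ_k
e_k`, and `x = ∑ λ_k s^{k+1} (s^*)^k` (`IsCornerPhase.eq_series`). Conversely, this series has phase
`s` and satisfies the relation (`isCornerPhase_series`, `series_relation`).

All generators. The phases satisfy `α_i^* α_i = Q_i` and `α_i α_i^* = Q_i - Q_{i-1}` for a chain of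
projections ending in `1` (`IsPhaseSystem`). Then `P_0 = Q_0`, `P_j = Q_j - Q_{j-1}`, `S_{ij} = α_i
P_j` is a Cuntz-Krieger family; one returns by `α_i = ∑_j S_{ij}` and `Q_i = ∑_{j ≤ i} P_j`. The
products of distinct generators required to vanish do so because the `P_j` are orthogonal.

Units. The graph algebra is a non-unital subalgebra of the universal unital algebra of the
Cuntz-Krieger relations, where `p = ∑ P_j` need not be `1`. As the ball relations require `Q_n = 1`,
the defect `1 - p` is added to `Q_n` and, for `n ≥ 1`, to `α_n` (`isPhaseSystem_family`). This gives
a unital `ψ` from the ball algebra to that unital algebra; the family above gives `φ` in the other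
direction. Here `p` commutes with the range of `ψ` and `φ(p) = 1`. The isomorphism is `a ↦ ψ(a) p`,
with inverse the restriction of `φ`: one composition is the identity because the `x_i` are
determined by their phases (`left_inverse`), the other by evaluation on the `P_v` and `S_e`
(`right_inverse_of_mem`). -/

theorem letter_inr (x : X) : letter (Sum.inr x) = star (gen x) :=
  (star_letter (Sum.inl x)).symm

theorem starAlgHom_ext {f g : FreeStarAlgebra X →⋆ₐ[ℂ] A} (h : ∀ x, f (gen x) = g (gen x)) :
    f = g := by
  ext a
  induction a using FreeStarAlgebra.induction with
  | h_scalar c => rw [AlgHomClass.commutes, AlgHomClass.commutes]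
  | h_letter s =>
    cases s with
    | inl x => exact h x
    | inr x => rw [letter_inr, map_star, map_star, h]
  | h_mul a b ha hb => rw [map_mul, map_mul, ha, hb]
  | h_add a b ha hb => rw [map_add, map_add, ha, hb]

end FreeStarAlgebra

namespace OperatorRelations

open UniformSpace

variable {X Y : Type} (R : OperatorRelations X) (R' : OperatorRelations Y)

/-- The canonical map of the free `*`-algebra to the universal `C^*`-algebra. -/
noncomputable def incl : FreeStarAlgebra X →⋆ₐ[ℂ] R.UniversalCStar where
  toFun a := ((Quot₀.mk R (Seminormed.of R a) : R.Quot₀) : Completion R.Quot₀)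
  map_one' := rfl
  map_mul' a b := Completion.coe_mul (α := R.Quot₀) (Quot₀.mk R (Seminormed.of R a))
    (Quot₀.mk R (Seminormed.of R b))
  map_zero' := rfl
  map_add' a b := Completion.coe_add (α := R.Quot₀) (Quot₀.mk R (Seminormed.of R a))
    (Quot₀.mk R (Seminormed.of R b))
  commutes' _ := rfl
  map_star' a := (Completion.star_coe (A := R.Quot₀) (Quot₀.mk R (Seminormed.of R a))).symm

theorem incl_gen (x : X) : R.incl (FreeStarAlgebra.gen x) = R.ugen x := rfl

theorem norm_incl (a : FreeStarAlgebra X) : ‖R.incl a‖ = R.supNorm a :=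
  Completion.norm_coe _

variable {R} in
-- The image of the free algebra is all of the quotient by `J₀`, which is dense in its completion.
theorem closed_induction {C : R.UniversalCStar → Prop} (hC : IsClosed {b | C b})
    (h : ∀ a, C (R.incl a)) (b : R.UniversalCStar) : C b := by
  induction b using Completion.induction_on with
  | hp => exact hC
  | ih a =>
    obtain ⟨a, rfl⟩ := Quot₀.mk_surjective R a
    exact h a

variable {R} in
/-- A closed property that holds for the scalars and the generators and is preserved by the
algebraic operations holds on the whole universal `C^*`-algebra. -/
theorem generator_induction {C : R.UniversalCStar → Prop} (hC : IsClosed {b | C b})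
    (h_scalar : ∀ c : ℂ, C (algebraMap ℂ R.UniversalCStar c))
    (h_gen : ∀ x, C (R.ugen x)) (h_star : ∀ x, C (star (R.ugen x)))
    (h_mul : ∀ a b, C a → C b → C (a * b))
    (h_add : ∀ a b, C a → C b → C (a + b)) (b : R.UniversalCStar) : C b := by
  refine closed_induction hC (fun a => ?_) b
  induction a using FreeStarAlgebra.induction with
  | h_scalar c => rw [AlgHomClass.commutes]; exact h_scalar c
  | h_letter s =>
    cases s with
    | inl x => exact h_gen x
    | inr x => rw [FreeStarAlgebra.letter_inr, map_star, incl_gen]; exact h_star x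
  | h_mul a b ha hb => rw [map_mul]; exact h_mul _ _ ha hb
  | h_add a b ha hb => rw [map_add]; exact h_add _ _ ha hb

theorem exists_norm_sub_incl_lt (b : R.UniversalCStar) {ε : ℝ} (hε : 0 < ε) :
    ∃ a, ‖b - R.incl a‖ < ε := by
  have : b ∈ closure (Set.range R.incl) := by
    refine closed_induction (C := fun b => b ∈ closure (Set.range R.incl)) isClosed_closure
      (fun a => subset_closure ⟨a, rfl⟩) b
  obtain ⟨_, ⟨a, rfl⟩, ha⟩ := Metric.mem_closure_iff.1 this ε hε
  exact ⟨a, by rwa [← dist_eq_norm]⟩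

section extend

variable {R} {D : Type*} [CStarAlgebra D]

/-- The extension of a contractive `*`-homomorphism to the universal `C^*`-algebra. -/
theorem exists_extension (f : FreeStarAlgebra X →⋆ₐ[ℂ] D) (hf : ∀ a, ‖f a‖ ≤ R.supNorm a) :
    ∃ F : R.UniversalCStar →⋆ₐ[ℂ] D, ∀ a, F (R.incl a) = f a := by
  let g₀ : R.Seminormed → D := f
  -- Contractivity for the seminorm serves twice: `f` kills `J₀`, and the induced map is uniformly
  -- continuous, hence extends to the completion.
  have hg₀ : ∀ a b : R.Seminormed, dist (g₀ a) (g₀ b) ≤ dist a b := fun a b => by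
    rw [dist_eq_norm, dist_eq_norm]
    have : g₀ a - g₀ b = f (a - b) := (map_sub f a b).symm
    rw [this]
    exact hf _
  have hlip₀ : LipschitzWith 1 g₀ := LipschitzWith.of_dist_le_mul fun a b => by
    simpa using hg₀ a b
  let g : R.Quot₀ → D := SeparationQuotient.lift g₀ fun a b h => by
    rw [← dist_le_zero]
    exact (hg₀ a b).trans (Metric.inseparable_iff.1 h).le
  have hg : ∀ a : R.Seminormed, g (Quot₀.mk R a) = g₀ a := fun a => rfl
  have hlip : LipschitzWith 1 g := LipschitzWith.of_dist_le_mul fun a b => by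
    obtain ⟨a, rfl⟩ := Quot₀.mk_surjective R a
    obtain ⟨b, rfl⟩ := Quot₀.mk_surjective R b
    rw [hg, hg, NNReal.coe_one, one_mul]
    exact hg₀ a b
  let F : R.UniversalCStar → D := Completion.extension g
  have hFc : Continuous F := Completion.continuous_extension
  have hF : ∀ a, F (R.incl a) = f a := fun a =>
    Completion.extension_coe hlip.uniformContinuous _
  refine ⟨{ toFun := F, map_one' := ?_, map_mul' := ?_, map_zero' := ?_, map_add' := ?_,
            commutes' := ?_, map_star' := ?_ }, hF⟩
  · rw [← map_one R.incl, hF, map_one]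
  · intro a b
    refine closed_induction (C := fun a => F (a * b) = F a * F b)
      (isClosed_eq (by fun_prop) (by fun_prop)) (fun a => ?_) a
    refine closed_induction (C := fun b => F (R.incl a * b) = F (R.incl a) * F b)
      (isClosed_eq (by fun_prop) (by fun_prop)) (fun b => ?_) b
    rw [← map_mul, hF, hF, hF, map_mul]
  · rw [← map_zero R.incl, hF, map_zero]
  · intro a b
    refine closed_induction (C := fun a => F (a + b) = F a + F b)
      (isClosed_eq (by fun_prop) (by fun_prop)) (fun a => ?_) a
    refine closed_induction (C := fun b => F (R.incl a + b) = F (R.incl a) + F b)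
      (isClosed_eq (by fun_prop) (by fun_prop)) (fun b => ?_) b
    rw [← map_add, hF, hF, hF, map_add]
  · intro c
    have := hF (algebraMap ℂ _ c)
    rwa [AlgHomClass.commutes, AlgHomClass.commutes] at this
  · intro a
    refine closed_induction (C := fun a => F (star a) = star (F a))
      (isClosed_eq (hFc.comp continuous_star) hFc.star) (fun a => ?_) a
    rw [← map_star, hF, hF, map_star]

theorem starAlgHom_continuous {E : Type*} [CStarAlgebra E] (F : E →⋆ₐ[ℂ] D) : Continuous F :=
  AddMonoidHomClass.continuous_of_bound F 1 fun a => by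
    rw [one_mul]
    exact NonUnitalStarAlgHom.norm_apply_le F a

theorem universal_hom_ext {F G : R.UniversalCStar →⋆ₐ[ℂ] D}
    (h : ∀ x, F (R.ugen x) = G (R.ugen x)) (b : R.UniversalCStar) : F b = G b := by
  refine closed_induction (C := fun b => F b = G b)
    (isClosed_eq (starAlgHom_continuous F) (starAlgHom_continuous G)) (fun a => ?_) b
  exact DFunLike.congr_fun (FreeStarAlgebra.starAlgHom_ext
    (f := F.comp R.incl) (g := G.comp R.incl) h) a

end extend

/-! ### Representations determine the norm of the universal algebra. -/

section rep

variable {R} {H : Type} [NormedAddCommGroup H] [InnerProductSpace ℂ H] [CompleteSpace H]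

theorem exists_rep {T : X → H →L[ℂ] H} (hT : R.Holds H T) :
    ∃ F : R.UniversalCStar →⋆ₐ[ℂ] (H →L[ℂ] H),
      ∀ a, F (R.incl a) = FreeStarAlgebra.lift T a :=
  exists_extension _ fun _ => R.le_supNorm ⟨H, _, _, _, T, hT, rfl⟩

/-- The representation of the universal `C^*`-algebra on operators that satisfy the relations. -/
noncomputable def rep {T : X → H →L[ℂ] H} (hT : R.Holds H T) :
    R.UniversalCStar →⋆ₐ[ℂ] (H →L[ℂ] H) :=
  (exists_rep hT).choose

theorem rep_incl {T : X → H →L[ℂ] H} (hT : R.Holds H T) (a : FreeStarAlgebra X) :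
    rep hT (R.incl a) = FreeStarAlgebra.lift T a :=
  (exists_rep hT).choose_spec a

theorem rep_ugen {T : X → H →L[ℂ] H} (hT : R.Holds H T) (x : X) : rep hT (R.ugen x) = T x := by
  rw [← incl_gen, rep_incl, FreeStarAlgebra.lift_gen]

end rep

variable {R}

/-- For polynomials the norm is by definition a supremum over representations; since representations
are contractive, approximation by polynomials carries the bound to the completion. -/
theorem norm_le_of_forall_rep {b : R.UniversalCStar} {C : ℝ} (hC : 0 ≤ C)
    (h : ∀ (H : Type) [NormedAddCommGroup H] [InnerProductSpace ℂ H] [CompleteSpace H]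
      (T : X → H →L[ℂ] H) (hT : R.Holds H T), ‖rep hT b‖ ≤ C) : ‖b‖ ≤ C := by
  refine le_of_forall_pos_le_add fun ε hε => ?_
  obtain ⟨a, ha⟩ := R.exists_norm_sub_incl_lt b (half_pos hε)
  have h1 : R.supNorm a ≤ C + ε / 2 := by
    refine R.supNorm_le (by positivity) ?_
    rintro _ ⟨H, _, _, _, T, hT, rfl⟩
    rw [← rep_incl hT]
    have h2 : ‖rep hT (b - R.incl a)‖ ≤ ‖b - R.incl a‖ := NonUnitalStarAlgHom.norm_apply_le _ _
    rw [map_sub] at h2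
    have h3 := norm_sub_norm_le (rep hT (R.incl a)) (rep hT b)
    rw [norm_sub_rev] at h3
    linarith [h H T hT]
  have h4 := norm_sub_norm_le b (R.incl a)
  rw [norm_incl] at h4
  linarith

theorem eq_of_forall_rep {b c : R.UniversalCStar}
    (h : ∀ (H : Type) [NormedAddCommGroup H] [InnerProductSpace ℂ H] [CompleteSpace H]
      (T : X → H →L[ℂ] H) (hT : R.Holds H T), rep hT b = rep hT c) : b = c := by
  rw [← sub_eq_zero, ← norm_le_zero_iff]
  refine norm_le_of_forall_rep le_rfl fun H _ _ _ T hT => ?_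
  rw [map_sub, h H T hT, sub_self, norm_zero]

/-- Elements of a universal `C^*`-algebra that satisfy the relations in every representation
define a homomorphism. -/
theorem exists_universal_hom {R' : OperatorRelations Y} (y : X → R'.UniversalCStar)
    (h : ∀ (H : Type) [NormedAddCommGroup H] [InnerProductSpace ℂ H] [CompleteSpace H]
      (T : Y → H →L[ℂ] H) (hT : R'.Holds H T), R.Holds H (fun x => rep hT (y x))) :
    ∃ F : R.UniversalCStar →⋆ₐ[ℂ] R'.UniversalCStar, ∀ x, F (R.ugen x) = y x := by
  obtain ⟨F, hF⟩ := exists_extension (R := R) (FreeStarAlgebra.lift y) fun a => by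
    refine norm_le_of_forall_rep (R.supNorm_nonneg a) fun H _ _ _ T hT => ?_
    refine R.le_supNorm ⟨H, _, _, _, _, h H T hT, ?_⟩
    congr 1
    refine DFunLike.congr_fun (FreeStarAlgebra.starAlgHom_ext
      (f := (rep hT).comp (FreeStarAlgebra.lift y)) fun x => ?_) a
    rw [StarAlgHom.comp_apply, FreeStarAlgebra.lift_gen, FreeStarAlgebra.lift_gen]
  exact ⟨F, fun x => by rw [← incl_gen, hF, FreeStarAlgebra.lift_gen]⟩

end OperatorRelations

/-! ### Phases in corners -/

namespace QuantumBall

section CStar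

variable {A : Type*} [CStarAlgebra A]

section order

variable [PartialOrder A] [StarOrderedRing A]

theorem modulus_eq_sqrt (x : A) : modulus x = CFC.sqrt (star x * x) := by
  rw [CFC.sqrt_eq_real_sqrt _ (star_mul_self_nonneg x), cfcₙ_eq_cfc]
  rfl

theorem modulus_eq_of_nonneg {x y : A} (hy : 0 ≤ y) (h : y * y = star x * x) :
    modulus x = y := by
  rw [modulus_eq_sqrt]
  exact CFC.sqrt_unique h hy

theorem coe_smul_nonneg {r : ℝ} (hr : 0 ≤ r) {a : A} (ha : 0 ≤ a) : 0 ≤ (r : ℂ) • a := by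
  rw [Complex.coe_smul]
  exact smul_nonneg hr ha

theorem isUnit_coe_smul_one_add {r : ℝ} (hr : 0 < r) {a : A} (ha : 0 ≤ a) :
    IsUnit ((r : ℂ) • (1 : A) + a) := by
  have h : IsUnit ((r : ℂ) • (1 : A)) := by
    rw [← Algebra.algebraMap_eq_smul_one]
    exact (IsUnit.mk0 (r : ℂ) (by exact_mod_cast hr.ne')).map (algebraMap ℂ A)
  have h' : IsStrictlyPositive ((r : ℂ) • (1 : A)) :=
    h.isStrictlyPositive (coe_smul_nonneg hr.le zero_le_one)
  exact (h'.add_nonneg ha).isUnit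

end order

theorem modulus_mul_self (x : A) : modulus x * modulus x = star x * x := by
  let := CStarAlgebra.spectralOrder A
  let := CStarAlgebra.spectralOrderedRing A
  rw [modulus_eq_sqrt]
  exact CFC.sqrt_mul_sqrt_self _ (star_mul_self_nonneg x)

theorem star_modulus (x : A) : star (modulus x) = modulus x :=
  (cfc_predicate (p := (IsSelfAdjoint : A → Prop)) (fun t : ℝ => Real.sqrt t) (star x * x)).star_eq

/-- As `x^* x (p - 1) = 0`, the `C^*`-identity kills `|x| (p - 1)`. -/
theorem modulus_mul_eq {p x : A} (hp : IsStarProjection p) (hx : p * x * p = x) :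
    modulus x * p = modulus x := by
  have hxp : x * p = x := by rw [← hx, mul_assoc, hp.isIdempotentElem.eq]
  have h : star (modulus x * p - modulus x) * (modulus x * p - modulus x) = 0 := by
    have e1 : modulus x * p - modulus x = modulus x * (p - 1) := by rw [mul_sub, mul_one]
    rw [e1, star_mul, star_modulus, mul_assoc, ← mul_assoc (modulus x), modulus_mul_self,
      mul_assoc (star x), mul_sub, hxp, mul_one, sub_self, mul_zero, mul_zero]
  rwa [CStarRing.star_mul_self_eq_zero_iff, sub_eq_zero] at h

theorem mul_modulus_eq {p x : A} (hp : IsStarProjection p) (hx : p * x * p = x) :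
    p * modulus x = modulus x := by
  have := congrArg star (modulus_mul_eq hp hx)
  rwa [star_mul, star_modulus, hp.isSelfAdjoint.star_eq] at this

/-- The `q`-relation makes the modulus invertible in the corner. -/
theorem exists_isCornerPhase {q : ℝ} (hq0 : 0 < q) (hq1 : q < 1) {p x : A}
    (hp : IsStarProjection p) (hx : p * x * p = x)
    (h : star x * x - (q : ℂ) • (x * star x) = ((1 - q : ℝ) : ℂ) • p) :
    ∃ α, IsCornerPhase p x α := by
  let := CStarAlgebra.spectralOrder A
  let := CStarAlgebra.spectralOrderedRing A
  have h1 := modulus_mul_eq hp hx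
  have h2 := mul_modulus_eq hp hx
  have hpp := hp.isIdempotentElem.eq
  set y := modulus x with hy
  -- Filling up by `1 - p` replaces invertibility in the corner by invertibility in `A`. By the
  -- relation, `c² = (1-q) 1 + q (1-p) + q x x^*`, which is at least `1 - q > 0`.
  set c := y + (1 - p) with hc
  have hcp : c * p = y := by
    rw [hc, add_mul, h1, sub_mul, one_mul, hpp, sub_self, add_zero]
  have hpc : p * c = y := by
    rw [hc, mul_add, h2, mul_sub, mul_one, hpp, sub_self, add_zero]
  have hcc : c * c = ((1 - q : ℝ) : ℂ) • (1 : A) +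
      ((q : ℂ) • (1 - p) + (q : ℂ) • (x * star x)) := by
    have e : c * c = star x * x + (1 - p) := by
      rw [← modulus_mul_self, ← hy, hc]
      simp only [add_mul, mul_add, mul_sub, sub_mul, one_mul, mul_one, h1, h2, hpp]
      abel
    rw [e, sub_eq_iff_eq_add.1 h]
    push_cast
    module
  have hunit : IsUnit c := by
    have hu : IsUnit (c ^ 2) := by
      rw [pow_two, hcc]
      refine isUnit_coe_smul_one_add (by linarith) (add_nonneg ?_ ?_)
      · exact coe_smul_nonneg hq0.le hp.one_sub.nonneg
      · exact coe_smul_nonneg hq0.le (mul_star_self_nonneg x)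
    exact (isUnit_pow_iff two_ne_zero).1 hu
  obtain ⟨u, hu⟩ := hunit
  -- The inverse of `c` commutes with `p`, so its compression `p c⁻¹` is the inverse of `|x|` in the
  -- corner.
  have hcomm : p * (↑u⁻¹ : A) = ↑u⁻¹ * p := by
    have : Commute p (u : A) := by rw [hu]; exact hpc.trans hcp.symm
    exact this.units_inv_right.eq
  refine ⟨x * (p * ↑u⁻¹), hp, hx, p * ↑u⁻¹, ?_, ?_, ?_, rfl⟩
  · rw [← mul_assoc, hpp, mul_assoc, ← hcomm, ← mul_assoc, hpp]
  · rw [hcomm, mul_assoc, h2, ← hcp, ← hu, Units.inv_mul_cancel_left]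
  · rw [← mul_assoc, h1, ← hpc, ← hu, Units.mul_inv_cancel_right]

namespace IsCornerPhase

variable {p x α β : A}

theorem unique (h : IsCornerPhase p x α) (h' : IsCornerPhase p x β) : α = β := by
  obtain ⟨hp, -, b, hb, hb1, hb2, rfl⟩ := h
  obtain ⟨-, -, c, hc, hc1, hc2, rfl⟩ := h'
  have hbp : b * p = b := by rw [← hb, mul_assoc, hp.isIdempotentElem.eq]
  have hpc : p * c = c := by rw [← hc, ← mul_assoc, ← mul_assoc, hp.isIdempotentElem.eq]
  have : b = c := by rw [← hbp, ← hc2, ← mul_assoc, hb1, hpc]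
  rw [this]

/-- A `*`-homomorphism preserves positivity, so by uniqueness of positive square roots it preserves
moduli; the remaining conditions are equations. -/
theorem map {B : Type*} [CStarAlgebra B] (F : A →⋆ₐ[ℂ] B) (h : IsCornerPhase p x α) :
    IsCornerPhase (F p) (F x) (F α) := by
  obtain ⟨hp, hx, b, hb, hb1, hb2, rfl⟩ := h
  have hF : F (modulus x) = modulus (F x) := by
    let := CStarAlgebra.spectralOrder A
    let := CStarAlgebra.spectralOrderedRing A
    let := CStarAlgebra.spectralOrder B
    let := CStarAlgebra.spectralOrderedRing B
    refine (modulus_eq_of_nonneg ?_ ?_).symm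
    · rw [modulus_eq_sqrt]
      exact map_nonneg F (CFC.sqrt_nonneg _)
    · rw [← map_mul, modulus_mul_self, map_mul, map_star]
  refine ⟨hp.map F, by rw [← map_mul, ← map_mul, hx], F b, ?_, ?_, ?_, map_mul _ _ _⟩
  · rw [← map_mul, ← map_mul, hb]
  · rw [← hF, ← map_mul, hb1]
  · rw [← hF, ← map_mul, hb2]

theorem eq_mul_modulus (h : IsCornerPhase p x α) : x = α * modulus x := by
  obtain ⟨hp, hx, b, hb, hb1, hb2, rfl⟩ := h
  rw [mul_assoc, hb1]
  nth_rw 2 [← hx]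
  rw [mul_assoc, hp.isIdempotentElem.eq, hx]

theorem star_mul_self (h : IsCornerPhase p x α) : star α * α = p := by
  obtain ⟨hp, hx, b, hb, hb1, hb2, rfl⟩ := h
  rw [star_mul, mul_assoc, ← mul_assoc (star x), ← modulus_mul_self, mul_assoc (modulus x), hb2,
    modulus_mul_eq hp hx]
  have : star (modulus x * b) = star b * modulus x := by rw [star_mul, star_modulus]
  rw [← this, hb2, hp.isSelfAdjoint.star_eq]

theorem mul_left (h : IsCornerPhase p x α) : p * α = α := by
  obtain ⟨hp, hx, b, hb, hb1, hb2, rfl⟩ := h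
  rw [← hx, ← mul_assoc, ← mul_assoc, ← mul_assoc, hp.isIdempotentElem.eq]

end IsCornerPhase

end CStar

end QuantumBall

/-! ### The series of a partial isometry -/

namespace QuantumBall

open Filter Topology

/-! ### The coefficients of the series. -/

section coeff

variable {q : ℝ}

theorem coeff_nonneg (hq0 : 0 < q) (hq1 : q < 1) (k : ℕ) : 0 ≤ coeff q k := by
  have : q ^ (k + 1) ≤ q ^ k := pow_le_pow_of_le_one hq0.le hq1.le k.le_succ
  exact sub_nonneg.2 (Real.sqrt_le_sqrt (by linarith))

theorem sum_coeff (q : ℝ) (N : ℕ) :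
    ∑ k ∈ Finset.range N, coeff q k = Real.sqrt (1 - q ^ N) := by
  unfold coeff
  rw [Finset.sum_range_sub (fun k => Real.sqrt (1 - q ^ k))]
  simp

theorem summable_coeff (hq0 : 0 < q) (hq1 : q < 1) : Summable (coeff q) := by
  refine summable_of_sum_range_le (c := 1) (coeff_nonneg hq0 hq1) fun N => ?_
  rw [sum_coeff]
  refine Real.sqrt_le_one.2 ?_
  linarith [pow_pos hq0 N]

/-- The left side is the difference of the squares of `√(1 - q^{k+1})` and `√(1 - q^k)`. It is what
the square of a partial sum of `∑ λ_k e_k` gains with one more term. -/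
theorem coeff_sq (hq0 : 0 < q) (hq1 : q < 1) (k : ℕ) :
    2 * coeff q k * Real.sqrt (1 - q ^ k) + coeff q k * coeff q k = (1 - q) * q ^ k := by
  have h (m : ℕ) : Real.sqrt (1 - q ^ m) * Real.sqrt (1 - q ^ m) = 1 - q ^ m :=
    Real.mul_self_sqrt (sub_nonneg.2 (pow_le_one₀ hq0.le hq1.le))
  have h1 := h k
  have h2 := h (k + 1)
  unfold coeff
  rw [pow_succ] at h2 ⊢
  linear_combination h2 - h1

end coeff

variable {A : Type*} [CStarAlgebra A]

/-- The decreasing sequence `e_0 = Q`, `e_{k+1} = s e_k s^*` of projections. -/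
def rangeProj (Q s : A) : ℕ → A
  | 0 => Q
  | k + 1 => s * rangeProj Q s k * star s

/-- `s` is a partial isometry with initial projection `Q` whose range lies in that of `Q`. -/
structure IsCornerIsometry (Q s : A) : Prop where
  proj : IsStarProjection Q
  star_mul_self : star s * s = Q
  mul_left : Q * s = s

namespace IsCornerIsometry

variable {Q s : A} (h : IsCornerIsometry Q s)
include h

theorem mul_right : s * Q = s := by
  have : star (s * Q - s) * (s * Q - s) = 0 := by
    have e : s * Q - s = s * (Q - 1) := by rw [mul_sub, mul_one]
    rw [e, star_mul, mul_assoc, ← mul_assoc (star s), h.star_mul_self, mul_sub,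
      h.proj.isIdempotentElem.eq, mul_one, sub_self, mul_zero]
  rwa [CStarRing.star_mul_self_eq_zero_iff, sub_eq_zero] at this

theorem star_mul_right : star s * Q = star s := by
  simpa [h.proj.isSelfAdjoint.star_eq] using congrArg star h.mul_left

theorem mul_rangeProj (k : ℕ) : Q * rangeProj Q s k = rangeProj Q s k := by
  cases k with
  | zero => exact h.proj.isIdempotentElem.eq
  | succ k => rw [rangeProj, ← mul_assoc, ← mul_assoc, h.mul_left]

/-- In `s e_j s^* s e_k s^*` the inner `s^* s = Q` is absorbed by `e_k`, so the order of `e_j` and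
`e_k` passes to their successors. -/
theorem rangeProj_mul_of_le {j k : ℕ} (hjk : j ≤ k) :
    rangeProj Q s j * rangeProj Q s k = rangeProj Q s k := by
  induction j generalizing k with
  | zero => exact h.mul_rangeProj k
  | succ j ih =>
    obtain ⟨k, rfl⟩ := Nat.exists_eq_add_of_le' (Nat.one_le_of_lt hjk)
    calc rangeProj Q s (j + 1) * rangeProj Q s (k + 1)
        = s * (rangeProj Q s j * ((star s * s) * rangeProj Q s k)) * star s := by
          simp only [rangeProj, mul_assoc]
      _ = rangeProj Q s (k + 1) := by
          rw [h.star_mul_self, h.mul_rangeProj, ih (by omega), rangeProj]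

theorem star_rangeProj (k : ℕ) : star (rangeProj Q s k) = rangeProj Q s k := by
  induction k with
  | zero => exact h.proj.isSelfAdjoint.star_eq
  | succ k ih => rw [rangeProj, star_mul, star_mul, star_star, ih, mul_assoc]

theorem rangeProj_mul_of_le' {j k : ℕ} (hjk : j ≤ k) :
    rangeProj Q s k * rangeProj Q s j = rangeProj Q s k := by
  simpa [h.star_rangeProj] using congrArg star (h.rangeProj_mul_of_le hjk)

theorem isStarProjection_rangeProj (k : ℕ) : IsStarProjection (rangeProj Q s k) :=
  ⟨h.rangeProj_mul_of_le le_rfl, h.star_rangeProj k⟩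

/-- The extra factor `s` on the left absorbs `e_0 = Q`, so no corner projection survives in the
formula, even at `k = 0`. -/
theorem mul_rangeProj_eq_pow (k : ℕ) : s * rangeProj Q s k = s ^ (k + 1) * star s ^ k := by
  induction k with
  | zero => rw [rangeProj, h.mul_right]; simp
  | succ k ih =>
    rw [rangeProj, ← mul_assoc, ih, pow_succ' s (k + 1), pow_succ (star s)]
    simp only [mul_assoc]

theorem summable_smul_rangeProj {c : ℕ → ℝ} (hc : ∀ k, 0 ≤ c k) (hs : Summable c) :
    Summable fun k => (c k : ℂ) • rangeProj Q s k := by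
  refine Summable.of_norm_bounded hs fun k => ?_
  rw [norm_smul, Complex.norm_real, Real.norm_of_nonneg (hc k)]
  exact mul_le_of_le_one_right (hc k) (h.isStarProjection_rangeProj k).norm_le

end IsCornerIsometry

/-- `∑ λ_k e_k`, the modulus of the element with phase `s`. -/
noncomputable def modulusSeries (q : ℝ) (Q s : A) : A := ∑' k, (coeff q k : ℂ) • rangeProj Q s k

/-- `∑ (1 - q) q^k e_k`, the square of the modulus. -/
noncomputable def squareSeries (q : ℝ) (Q s : A) : A :=
  ∑' k, (((1 - q) * q ^ k : ℝ) : ℂ) • rangeProj Q s k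

/-! ### The modulus series, its square, and the `q`-relation. -/

namespace IsCornerIsometry

variable {Q s : A} (h : IsCornerIsometry Q s) {q : ℝ} (hq0 : 0 < q) (hq1 : q < 1)
include h hq0 hq1

theorem hasSum_modulusSeries :
    HasSum (fun k => (coeff q k : ℂ) • rangeProj Q s k) (modulusSeries q Q s) :=
  (h.summable_smul_rangeProj (coeff_nonneg hq0 hq1) (summable_coeff hq0 hq1)).hasSum

theorem hasSum_squareSeries :
    HasSum (fun k => (((1 - q) * q ^ k : ℝ) : ℂ) • rangeProj Q s k) (squareSeries q Q s) :=
  (h.summable_smul_rangeProj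
    (fun k => mul_nonneg (sub_nonneg.2 hq1.le) (pow_nonneg hq0.le k))
    ((summable_geometric_of_lt_one hq0.le hq1).mul_left _)).hasSum

/-- Since `e_k e_N = e_N` for `k ≤ N`, the `N`-th partial sum acts on `e_N` as the scalar `∑_{k<N}
λ_k = √(1 - q^N)`; then `coeff_sq` gives the new term of the square. -/
theorem sum_mul_self (N : ℕ) :
    (∑ k ∈ Finset.range N, (coeff q k : ℂ) • rangeProj Q s k) *
      (∑ k ∈ Finset.range N, (coeff q k : ℂ) • rangeProj Q s k) =
    ∑ k ∈ Finset.range N, (((1 - q) * q ^ k : ℝ) : ℂ) • rangeProj Q s k := by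
  induction N with
  | zero => simp
  | succ N ih =>
    have h1 : (∑ k ∈ Finset.range N, (coeff q k : ℂ) • rangeProj Q s k) * rangeProj Q s N
        = (Real.sqrt (1 - q ^ N) : ℂ) • rangeProj Q s N := by
      rw [← sum_coeff, Complex.ofReal_sum, Finset.sum_mul, Finset.sum_smul]
      refine Finset.sum_congr rfl fun k hk => ?_
      rw [smul_mul_assoc, h.rangeProj_mul_of_le (Finset.mem_range.1 hk).le]
    have h2 : rangeProj Q s N * (∑ k ∈ Finset.range N, (coeff q k : ℂ) • rangeProj Q s k)
        = (Real.sqrt (1 - q ^ N) : ℂ) • rangeProj Q s N := by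
      rw [← sum_coeff, Complex.ofReal_sum, Finset.mul_sum, Finset.sum_smul]
      refine Finset.sum_congr rfl fun k hk => ?_
      rw [mul_smul_comm, h.rangeProj_mul_of_le' (Finset.mem_range.1 hk).le]
    rw [Finset.sum_range_succ, Finset.sum_range_succ, add_mul, mul_add, mul_add, ih,
      mul_smul_comm, h1, smul_mul_assoc, h2, smul_mul_smul_comm, h.rangeProj_mul_of_le le_rfl,
      ← coeff_sq hq0 hq1 N]
    push_cast
    module

theorem modulusSeries_mul_self :
    modulusSeries q Q s * modulusSeries q Q s = squareSeries q Q s := by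
  have h1 := (h.hasSum_modulusSeries hq0 hq1).tendsto_sum_nat
  have h2 := (h.hasSum_squareSeries hq0 hq1).tendsto_sum_nat
  refine tendsto_nhds_unique (h1.mul h1) ?_
  simpa only [h.sum_mul_self hq0 hq1] using h2

/-- Conjugation by `s` shifts `e_k` to `e_{k+1}` and the factor `q` shifts the coefficient, so the
last summand is the series without its term `k = 0`. -/
theorem squareSeries_eq :
    squareSeries q Q s =
      ((1 - q : ℝ) : ℂ) • Q + (q : ℂ) • (s * squareSeries q Q s * star s) := by
  have h1 := h.hasSum_squareSeries hq0 hq1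
  have h2 := (hasSum_nat_add_iff' 1).2 h1
  have h3 := ((h1.mul_left s).mul_right (star s)).const_smul (q : ℂ)
  have h4 : squareSeries q Q s - ∑ k ∈ Finset.range 1,
      (((1 - q) * q ^ k : ℝ) : ℂ) • rangeProj Q s k
        = (q : ℂ) • (s * squareSeries q Q s * star s) := by
    have e : (fun k => (q : ℂ) • (s * (((1 - q) * q ^ k : ℝ) : ℂ) • rangeProj Q s k * star s))
        = fun k => (((1 - q) * q ^ (k + 1) : ℝ) : ℂ) • rangeProj Q s (k + 1) := by
      funext k
      rw [rangeProj, mul_smul_comm, smul_mul_assoc, smul_smul, ← Complex.ofReal_mul]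
      ring_nf
    rw [e] at h3
    exact h2.unique h3
  rw [← h4]
  simp [rangeProj]

theorem star_modulusSeries : star (modulusSeries q Q s) = modulusSeries q Q s := by
  have h1 := h.hasSum_modulusSeries hq0 hq1
  refine h1.star.unique ?_
  simpa [star_smul, h.star_rangeProj] using h1

theorem modulusSeries_nonneg [PartialOrder A] [StarOrderedRing A] :
    0 ≤ modulusSeries q Q s :=
  (h.hasSum_modulusSeries hq0 hq1).nonneg fun k =>
    coe_smul_nonneg (coeff_nonneg hq0 hq1 k) (h.isStarProjection_rangeProj k).nonneg

theorem mul_modulusSeries : Q * modulusSeries q Q s = modulusSeries q Q s := by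
  have h1 := h.hasSum_modulusSeries hq0 hq1
  refine (h1.mul_left Q).unique ?_
  simpa [h.mul_rangeProj] using h1

theorem hasSum_mul_modulusSeries :
    HasSum (fun k => (coeff q k : ℂ) • (s ^ (k + 1) * star s ^ k)) (s * modulusSeries q Q s) := by
  have := (h.hasSum_modulusSeries hq0 hq1).mul_left s
  simpa only [mul_smul_comm, h.mul_rangeProj_eq_pow] using this

theorem star_mul_self_series :
    star (s * modulusSeries q Q s) * (s * modulusSeries q Q s) = squareSeries q Q s := by
  rw [star_mul, mul_assoc, ← mul_assoc (star s), h.star_mul_self, h.mul_modulusSeries hq0 hq1,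
    h.star_modulusSeries hq0 hq1, h.modulusSeries_mul_self hq0 hq1]

theorem modulus_series : modulus (s * modulusSeries q Q s) = modulusSeries q Q s := by
  let := CStarAlgebra.spectralOrder A
  let := CStarAlgebra.spectralOrderedRing A
  refine modulus_eq_of_nonneg (h.modulusSeries_nonneg hq0 hq1) ?_
  rw [h.star_mul_self_series hq0 hq1, h.modulusSeries_mul_self hq0 hq1]

/-- This is the fixed point equation `squareSeries_eq`, with both products expressed by the squared
modulus. -/
theorem series_relation :
    star (s * modulusSeries q Q s) * (s * modulusSeries q Q s)
      - (q : ℂ) • (s * modulusSeries q Q s * star (s * modulusSeries q Q s))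
      = ((1 - q : ℝ) : ℂ) • Q := by
  have e : s * modulusSeries q Q s * star (s * modulusSeries q Q s)
      = s * squareSeries q Q s * star s := by
    rw [star_mul, h.star_modulusSeries hq0 hq1, ← h.modulusSeries_mul_self hq0 hq1]
    simp only [mul_assoc]
  rw [e, h.star_mul_self_series hq0 hq1, sub_eq_iff_eq_add]
  exact h.squareSeries_eq hq0 hq1

theorem isCornerPhase_series : IsCornerPhase Q (s * modulusSeries q Q s) s := by
  have hQz : Q * (s * modulusSeries q Q s) * Q = s * modulusSeries q Q s := by
    have h1 := congrArg star (h.mul_modulusSeries hq0 hq1)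
    rw [star_mul, h.star_modulusSeries hq0 hq1, h.proj.isSelfAdjoint.star_eq] at h1
    rw [← mul_assoc, h.mul_left, mul_assoc, h1]
  obtain ⟨α, hα⟩ := exists_isCornerPhase hq0 hq1 h.proj hQz (h.series_relation hq0 hq1)
  -- With `b` the corner inverse of the modulus, the phase is `s|x| b = s Q = s`.
  have : α = s := by
    obtain ⟨-, -, b, -, -, hb, rfl⟩ := hα
    rw [h.modulus_series hq0 hq1] at hb
    rw [mul_assoc, hb, h.mul_right]
  rwa [this] at hα

end IsCornerIsometry

theorem IsCornerPhase.isCornerIsometry {Q x α : A} (h : IsCornerPhase Q x α) :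
    IsCornerIsometry Q α :=
  ⟨h.1, h.star_mul_self, h.mul_left⟩

/-- The `q`-relation determines an element of the corner from its phase. -/
theorem IsCornerPhase.eq_series {q : ℝ} (hq0 : 0 < q) (hq1 : q < 1) {Q x α : A}
    (h : IsCornerPhase Q x α)
    (hrel : star x * x - (q : ℂ) • (x * star x) = ((1 - q : ℝ) : ℂ) • Q) :
    x = α * modulusSeries q Q α := by
  have hα := h.isCornerIsometry
  have hxx : x * star x = α * (star x * x) * star α := by
    nth_rw 1 [h.eq_mul_modulus]
    nth_rw 2 [h.eq_mul_modulus]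
    rw [star_mul, star_modulus, ← modulus_mul_self]
    simp only [mul_assoc]
  -- Both terms solve the same affine equation, so `d = q α d α^*`; with `‖α‖ ≤ 1` and `q < 1` this
  -- forces `d = 0`.
  set d := star x * x - squareSeries q Q α with hd
  have hdd : d = (q : ℂ) • (α * d * star α) := by
    have h1 := sub_eq_iff_eq_add.1 hrel
    rw [hxx] at h1
    calc d = (((1 - q : ℝ) : ℂ) • Q + (q : ℂ) • (α * (star x * x) * star α))
          - (((1 - q : ℝ) : ℂ) • Q + (q : ℂ) • (α * squareSeries q Q α * star α)) := by
          rw [← h1, ← hα.squareSeries_eq hq0 hq1]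
      _ = _ := by
          rw [hd, mul_sub, sub_mul, smul_sub]
          abel
  have hα1 : ‖α‖ ≤ 1 := by
    have h1 := hα.proj.norm_le
    rw [← hα.star_mul_self, CStarRing.norm_star_mul_self] at h1
    nlinarith [norm_nonneg α]
  have hnorm : ‖d‖ ≤ q * ‖d‖ := by
    nth_rw 1 [hdd]
    rw [norm_smul, Complex.norm_real, Real.norm_of_nonneg hq0.le]
    refine mul_le_mul_of_nonneg_left ?_ hq0.le
    calc ‖α * d * star α‖ ≤ ‖α‖ * ‖d‖ * ‖α‖ := by
          rw [← norm_star α]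
          refine (norm_mul_le _ _).trans ?_
          rw [norm_star]
          exact mul_le_mul_of_nonneg_right (norm_mul_le _ _) (norm_nonneg _)
      _ ≤ 1 * ‖d‖ * 1 := by gcongr
      _ = ‖d‖ := by ring
  have hd0 : d = 0 := by
    rw [← norm_le_zero_iff]
    nlinarith [norm_nonneg d]
  have hmod : modulus x = modulusSeries q Q α := by
    let := CStarAlgebra.spectralOrder A
    let := CStarAlgebra.spectralOrderedRing A
    refine modulus_eq_of_nonneg (hα.modulusSeries_nonneg hq0 hq1) ?_
    rw [hα.modulusSeries_mul_self hq0 hq1, ← sub_eq_zero.1 hd0]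
  rw [← hmod]
  exact h.eq_mul_modulus

end QuantumBall

/-! ### Systems of phases -/

namespace QuantumBall

variable {A : Type*} [CStarAlgebra A] {n : ℕ}

/-- An increasing chain of projections that ends in `1`, together with partial isometries `α_i`
whose initial and final projections are `Q_i` and `Q_i - Q_{i-1}`. -/
structure IsPhaseSystem (Q : Fin (n + 1) → A) (α : Fin n → A) : Prop where
  proj : ∀ i, IsStarProjection (Q i)
  mul_of_le : ∀ i j, i ≤ j → Q i * Q j = Q i
  top : Q (Fin.last n) = 1
  star_mul_self : ∀ i, star (α i) * α i = Q i.succ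
  self_mul_star : ∀ i, α i * star (α i) = Q i.succ - Q i.castSucc

/-- The projections `Q_0` and `Q_j - Q_{j-1}`. -/
def vertexProj (Q : Fin (n + 1) → A) : Fin (n + 1) → A :=
  Fin.cases (Q 0) fun j => Q j.succ - Q j.castSucc

theorem vertexProj_zero (Q : Fin (n + 1) → A) : vertexProj Q 0 = Q 0 := rfl

theorem vertexProj_succ (Q : Fin (n + 1) → A) (j : Fin n) :
    vertexProj Q j.succ = Q j.succ - Q j.castSucc := rfl

theorem sum_Iic_castSucc_add {M : Type*} [AddCommMonoid M] (f : Fin (n + 1) → M) (i : Fin n) :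
    ∑ j ∈ Finset.Iic i.succ, f j = ∑ j ∈ Finset.Iic i.castSucc, f j + f i.succ := by
  have h : Finset.Iic i.succ = insert i.succ (Finset.Iic i.castSucc) := by
    ext j
    simp only [Finset.mem_Iic, Finset.mem_insert, Fin.le_def, Fin.ext_iff, Fin.val_succ,
      Fin.val_castSucc]
    omega
  rw [h, Finset.sum_insert (by simp), add_comm]

theorem sum_Iic_zero {M : Type*} [AddCommMonoid M] (f : Fin (n + 1) → M) :
    ∑ j ∈ Finset.Iic 0, f j = f 0 := by
  have h : Finset.Iic (0 : Fin (n + 1)) = {0} := by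
    ext j
    simp
  rw [h, Finset.sum_singleton]

theorem sum_vertexProj (Q : Fin (n + 1) → A) (i : Fin (n + 1)) :
    ∑ j ∈ Finset.Iic i, vertexProj Q j = Q i := by
  induction i using Fin.induction with
  | zero => rw [sum_Iic_zero, vertexProj_zero]
  | succ i ih => rw [sum_Iic_castSucc_add, ih, vertexProj_succ, add_sub_cancel]

namespace IsPhaseSystem

variable {Q : Fin (n + 1) → A} {α : Fin n → A} (h : IsPhaseSystem Q α)
include h

theorem mul_of_le' (i j : Fin (n + 1)) (hij : i ≤ j) : Q j * Q i = Q i := by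
  simpa [(h.proj _).isSelfAdjoint.star_eq] using congrArg star (h.mul_of_le i j hij)

/-- The final projection `Q_i - Q_{i-1}` of the phase lies below its initial projection `Q_i`. -/
theorem isCornerIsometry (i : Fin n) : IsCornerIsometry (Q i.succ) (α i) := by
  refine ⟨h.proj _, h.star_mul_self i, ?_⟩
  have e : (Q i.succ * α i - α i) * star (Q i.succ * α i - α i) = 0 := by
    have e1 : Q i.succ * α i - α i = (Q i.succ - 1) * α i := by rw [sub_mul, one_mul]
    rw [e1, star_mul, mul_assoc, ← mul_assoc (α i), h.self_mul_star i, ← mul_assoc, sub_mul,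
      mul_sub, h.mul_of_le' _ _ i.castSucc_lt_succ.le, (h.proj _).isIdempotentElem.eq, one_mul,
      sub_self, zero_mul]
  rwa [CStarRing.mul_star_self_eq_zero_iff, sub_eq_zero] at e

theorem isStarProjection_vertexProj (j : Fin (n + 1)) : IsStarProjection (vertexProj Q j) := by
  cases j using Fin.cases with
  | zero => exact h.proj 0
  | succ j =>
    rw [vertexProj_succ]
    exact (h.proj _).sub_of_mul_eq_left (h.proj _) (h.mul_of_le _ _ j.castSucc_lt_succ.le)

theorem vertexProj_mul_of_le {i j : Fin (n + 1)} (hij : i ≤ j) :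
    vertexProj Q i * Q j = vertexProj Q i := by
  cases i using Fin.cases with
  | zero => exact h.mul_of_le _ _ hij
  | succ i =>
    rw [vertexProj_succ, sub_mul, h.mul_of_le _ _ hij,
      h.mul_of_le _ _ (i.castSucc_lt_succ.le.trans hij)]

theorem mul_vertexProj_of_lt {i j : Fin (n + 1)} (hij : i < j) : Q i * vertexProj Q j = 0 := by
  cases j using Fin.cases with
  | zero => exact absurd hij (Fin.not_lt_zero _)
  | succ j =>
    have hj : i ≤ j.castSucc := by
      rw [Fin.lt_def, Fin.val_succ] at hij
      rw [Fin.le_def, Fin.val_castSucc]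
      omega
    rw [vertexProj_succ, mul_sub, h.mul_of_le _ _ hij.le, h.mul_of_le _ _ hj, sub_self]

theorem vertexProj_orthogonal {i j : Fin (n + 1)} (hij : i ≠ j) :
    vertexProj Q i * vertexProj Q j = 0 := by
  have key (i j : Fin (n + 1)) (hij : i < j) : vertexProj Q i * vertexProj Q j = 0 := by
    rw [← h.vertexProj_mul_of_le le_rfl, mul_assoc, h.mul_vertexProj_of_lt hij, mul_zero]
  rcases lt_or_gt_of_ne hij with hlt | hlt
  · exact key i j hlt
  · simpa [(h.isStarProjection_vertexProj _).isSelfAdjoint.star_eq] using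
      congrArg star (key j i hlt)

theorem vertexProj_mul_phase (i : Fin n) : vertexProj Q i.succ * α i = α i := by
  rw [vertexProj_succ, ← h.self_mul_star, mul_assoc, h.star_mul_self,
    (h.isCornerIsometry i).mul_right]

theorem star_phase_mul_vertexProj (i : Fin n) :
    star (α i) * vertexProj Q i.succ = star (α i) := by
  simpa [(h.isStarProjection_vertexProj _).isSelfAdjoint.star_eq] using
    congrArg star (h.vertexProj_mul_phase i)

/-- The series built from a system of phases satisfy the relations of the quantum ball. -/
theorem isBallSystem {q : ℝ} (hq0 : 0 < q) (hq1 : q < 1) :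
    IsBallSystem q (fun i => α i * modulusSeries q (Q i.succ) (α i)) Q α where
  mul_eq_zero i j hij := by
    have h1 := (h.isCornerIsometry i).isCornerPhase_series hq0 hq1
    -- The left factor ends in `Q i.succ`, the right one begins with `Q j.succ - Q j.castSucc`;
    -- these are orthogonal because `i < j`.
    have e1 : α i * modulusSeries q (Q i.succ) (α i)
        = α i * modulusSeries q (Q i.succ) (α i) * Q i.succ := by
      rw [← h1.2.1, mul_assoc _ (Q i.succ) (Q i.succ), h1.1.isIdempotentElem.eq]
    rw [e1, ← h.vertexProj_mul_phase j, mul_assoc _ (Q i.succ), mul_assoc (vertexProj Q _),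
      ← mul_assoc (Q i.succ), h.mul_vertexProj_of_lt (Fin.succ_lt_succ_iff.2 hij), zero_mul,
      mul_zero]
  star_mul_eq_zero i j hij := by
    have e : star (α i) * α j = 0 := by
      rw [← h.star_phase_mul_vertexProj i, ← h.vertexProj_mul_phase j, mul_assoc,
        ← mul_assoc (vertexProj Q _),
        h.vertexProj_orthogonal ((Fin.succ_injective n).ne hij), zero_mul, mul_zero]
    rw [star_mul, mul_assoc, ← mul_assoc (star (α i)), e, zero_mul, mul_zero]
  top := h.top
  phase i := (h.isCornerIsometry i).isCornerPhase_series hq0 hq1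
  step i := by rw [h.self_mul_star, sub_sub_cancel]
  qrel i := (h.isCornerIsometry i).series_relation hq0 hq1

end IsPhaseSystem

namespace IsBallSystem

variable {q : ℝ} {x : Fin n → A} {Q : Fin (n + 1) → A} {α : Fin n → A}
  (h : IsBallSystem q x Q α)
include h

theorem castSucc_mul_succ (i : Fin n) : Q i.castSucc * Q i.succ = Q i.castSucc := by
  have hα := (h.phase i).isCornerIsometry
  rw [h.step i, sub_mul, mul_assoc, hα.star_mul_right, hα.proj.isIdempotentElem.eq]

theorem isStarProjection (i : Fin (n + 1)) : IsStarProjection (Q i) := by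
  cases i using Fin.lastCases with
  | last => rw [h.top]; exact .one A
  | cast i =>
    have hα := (h.phase i).isCornerIsometry
    rw [h.step i]
    have hp : IsStarProjection (α i * star (α i)) := by
      refine ⟨?_, IsSelfAdjoint.mul_star_self _⟩
      change α i * star (α i) * (α i * star (α i)) = _
      rw [mul_assoc, ← mul_assoc (star (α i)), hα.star_mul_self, ← mul_assoc, hα.mul_right]
    refine hp.sub_of_mul_eq_left hα.proj ?_
    rw [mul_assoc, hα.star_mul_right]

theorem isPhaseSystem : IsPhaseSystem Q α where
  proj := h.isStarProjection
  mul_of_le i j hij := by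
    induction j using Fin.induction with
    | zero =>
      rw [Fin.le_zero_iff.1 hij]
      exact (h.isStarProjection 0).isIdempotentElem.eq
    | succ j ih =>
      rcases eq_or_lt_of_le hij with rfl | hlt
      · exact (h.isStarProjection _).isIdempotentElem.eq
      · have hj : i ≤ j.castSucc := by
          rw [Fin.lt_def, Fin.val_succ] at hlt
          rw [Fin.le_def, Fin.val_castSucc]
          omega
        rw [← ih hj, mul_assoc, h.castSucc_mul_succ]
  top := h.top
  star_mul_self i := (h.phase i).star_mul_self
  self_mul_star i := by rw [h.step, sub_sub_cancel]

theorem map {B : Type*} [CStarAlgebra B] (F : A →⋆ₐ[ℂ] B) :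
    IsBallSystem q (fun i => F (x i)) (fun i => F (Q i)) (fun i => F (α i)) where
  mul_eq_zero i j hij := by rw [← map_mul, h.mul_eq_zero i j hij, map_zero]
  star_mul_eq_zero i j hij := by rw [← map_star, ← map_mul, h.star_mul_eq_zero i j hij, map_zero]
  top := by rw [h.top, map_one]
  phase i := (h.phase i).map F
  step i := by rw [h.step, map_sub, map_mul, map_star]
  qrel i := by
    rw [← map_star, ← map_mul, ← map_mul, ← map_smul, ← map_sub, h.qrel, map_smul]

end IsBallSystem

end QuantumBall

/-! ### The graphs of the quantum balls -/

section ballGraph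

theorem ballVertex_last (n : ℕ) : ballVertex (n + 1) (Fin.last (n + 1)) = none :=
  Fin.lastCases_last

theorem ballVertex_castSucc (n : ℕ) (i : Fin (n + 1)) :
    ballVertex (n + 1) i.castSucc = some (ballVertex n i) :=
  Fin.lastCases_castSucc i

theorem ballVertex_bijective (n : ℕ) : Function.Bijective (ballVertex n) := by
  induction n with
  | zero => exact ⟨fun i j _ => Subsingleton.elim (α := Fin 1) i j, fun _ => ⟨0, rfl⟩⟩
  | succ n ih =>
    constructor
    · intro i j hij
      cases i using Fin.lastCases with
      | last =>
        cases j using Fin.lastCases with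
        | last => rfl
        | cast j =>
          rw [ballVertex_last, ballVertex_castSucc] at hij
          exact absurd hij.symm (Option.some_ne_none _)
      | cast i =>
        cases j using Fin.lastCases with
        | last =>
          rw [ballVertex_last, ballVertex_castSucc] at hij
          exact absurd hij (Option.some_ne_none _)
        | cast j =>
          rw [ballVertex_castSucc, ballVertex_castSucc] at hij
          rw [ih.1 (Option.some.inj hij)]
    · rintro (_ | v)
      · exact ⟨_, ballVertex_last n⟩
      · obtain ⟨i, rfl⟩ := ih.2 v
        exact ⟨_, ballVertex_castSucc n i⟩

/-- By induction: the new edges of a suspension leave the last vertex and reach every vertex once,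
while old edges keep their indices. With `ballGraph_exists_index` and `ballGraph_edge_ext` this
recovers the explicit description of `E_n`, in which `v_0` emits nothing. -/
theorem ballGraph_exists_edge {n : ℕ} (i : Fin n) (j : Fin (n + 1)) (hij : j ≤ i.succ) :
    ∃ e, (ballGraph n).source e = ballVertex n i.succ ∧
      (ballGraph n).range e = ballVertex n j := by
  induction n with
  | zero => exact i.elim0
  | succ n ih =>
    cases i using Fin.lastCases with
    | last => exact ⟨Sum.inr (ballVertex (n + 1) j), (ballVertex_last n).symm, rfl⟩
    | cast i =>
      cases j using Fin.lastCases with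
      | last =>
        exfalso
        rw [Fin.le_def, Fin.val_last, Fin.val_succ, Fin.val_castSucc] at hij
        omega
      | cast j =>
        obtain ⟨e, h1, h2⟩ := ih i j hij
        refine ⟨Sum.inl e, ?_, ?_⟩
        · rw [Fin.succ_castSucc, ballVertex_castSucc, ← h1]
          rfl
        · rw [ballVertex_castSucc, ← h2]
          rfl

theorem ballGraph_exists_index {n : ℕ} (e : (ballGraph n).Edge) :
    ∃ (i : Fin n) (j : Fin (n + 1)), j ≤ i.succ ∧
      (ballGraph n).source e = ballVertex n i.succ ∧
      (ballGraph n).range e = ballVertex n j := by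
  induction n with
  | zero => exact Empty.elim e
  | succ n ih =>
    rcases e with e | v
    · obtain ⟨i, j, hij, h1, h2⟩ := ih e
      refine ⟨i.castSucc, j.castSucc, hij, ?_, ?_⟩
      · rw [Fin.succ_castSucc, ballVertex_castSucc, ← h1]
        rfl
      · rw [ballVertex_castSucc, ← h2]
        rfl
    · obtain ⟨j, hj⟩ := (ballVertex_bijective (n + 1)).2 v
      exact ⟨Fin.last n, j, Fin.le_last _, (ballVertex_last n).symm, hj.symm⟩

theorem ballGraph_edge_ext {n : ℕ} {e f : (ballGraph n).Edge}
    (hs : (ballGraph n).source e = (ballGraph n).source f)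
    (hr : (ballGraph n).range e = (ballGraph n).range f) : e = f := by
  induction n with
  | zero => exact Empty.elim e
  | succ n ih =>
    rcases e with e | v <;> rcases f with f | w
    · exact congrArg Sum.inl (ih (Option.some.inj hs) (Option.some.inj hr))
    · exact absurd hs (Option.some_ne_none _)
    · exact absurd hs.symm (Option.some_ne_none _)
    · exact congrArg Sum.inr hr

theorem ballGraph_range_le {n : ℕ} {e : (ballGraph n).Edge} {i : Fin n} {j : Fin (n + 1)}
    (hs : (ballGraph n).source e = ballVertex n i.succ)
    (hr : (ballGraph n).range e = ballVertex n j) : j ≤ i.succ := by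
  obtain ⟨i', j', hij, h1, h2⟩ := ballGraph_exists_index e
  rw [← (ballVertex_bijective n).1 (hs.symm.trans h1),
    ← (ballVertex_bijective n).1 (hr.symm.trans h2)] at hij
  exact hij

theorem DirectedGraph.RowFinite.mem_out {E : DirectedGraph} (hE : E.RowFinite) {v : E.Vert}
    {e : E.Edge} : e ∈ hE.out v ↔ E.source e = v :=
  Set.Finite.mem_toFinset _

/-- The inverse of `ballVertex`. -/
noncomputable def vertexIndex {n : ℕ} (v : (ballGraph n).Vert) : Fin (n + 1) :=
  ((ballVertex_bijective n).2 v).choose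

theorem ballVertex_vertexIndex {n : ℕ} (v : (ballGraph n).Vert) :
    ballVertex n (vertexIndex v) = v :=
  ((ballVertex_bijective n).2 v).choose_spec

theorem vertexIndex_ballVertex {n : ℕ} (j : Fin (n + 1)) : vertexIndex (ballVertex n j) = j :=
  (ballVertex_bijective n).1 (ballVertex_vertexIndex _)

/-- Without multiple edges, the range map is a bijection from the edges emitted by `v_i` to `v_0, …,
v_i`. -/
theorem ballGraph_sum_out {n : ℕ} {M : Type*} [AddCommMonoid M] (i : Fin n)
    (g : (ballGraph n).Vert → M) :
    ∑ e ∈ (ballGraph_rowFinite n).out (ballVertex n i.succ), g ((ballGraph n).range e)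
      = ∑ j ∈ Finset.Iic i.succ, g (ballVertex n j) := by
  refine Finset.sum_bij (fun e _ => vertexIndex ((ballGraph n).range e)) ?_ ?_ ?_ ?_
  · intro e he
    exact Finset.mem_Iic.2 (ballGraph_range_le ((DirectedGraph.RowFinite.mem_out _).1 he)
      (ballVertex_vertexIndex _).symm)
  · intro e he f hf hef
    rw [DirectedGraph.RowFinite.mem_out] at he hf
    refine ballGraph_edge_ext (he.trans hf.symm) ?_
    rw [← ballVertex_vertexIndex ((ballGraph n).range e), hef, ballVertex_vertexIndex]
  · intro j hj
    obtain ⟨e, h1, h2⟩ := ballGraph_exists_edge i j (Finset.mem_Iic.1 hj)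
    exact ⟨e, (DirectedGraph.RowFinite.mem_out _).2 h1, by rw [h2, vertexIndex_ballVertex]⟩
  · intro e _
    rw [ballVertex_vertexIndex]

end ballGraph

/-! ### Cuntz-Krieger families and systems of phases -/

namespace DirectedGraph

theorem IsCuntzKriegerFamily.map {E : DirectedGraph} {hE : E.RowFinite} {A B : Type*} [Ring A]
    [StarRing A] [Algebra ℂ A] [Ring B] [StarRing B] [Algebra ℂ B] {P : E.Vert → A}
    {S : E.Edge → A} (h : IsCuntzKriegerFamily hE P S) (F : A →⋆ₐ[ℂ] B) :
    IsCuntzKriegerFamily hE (fun v => F (P v)) (fun e => F (S e)) where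
  proj v := (h.proj v).map F
  orthogonal v w hvw := by rw [← map_mul, h.orthogonal v w hvw, map_zero]
  star_mul_self e := by rw [← map_star, ← map_mul, h.star_mul_self]
  cuntz_krieger v hv := by
    rw [h.cuntz_krieger v hv, map_sum]
    simp only [map_mul, map_star]

/-- The relations are equations between polynomials, and representations separate points. -/
theorem isCuntzKriegerFamily_ugen {E : DirectedGraph} (hE : E.RowFinite) :
    IsCuntzKriegerFamily hE (fun v => (cuntzKrieger hE).ugen (Sum.inl v))
      (fun e => (cuntzKrieger hE).ugen (Sum.inr e)) where
  proj v := by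
    constructor
    · refine OperatorRelations.eq_of_forall_rep fun H _ _ _ T hT => ?_
      rw [map_mul, OperatorRelations.rep_ugen]
      exact (hT.proj v).isIdempotentElem.eq
    · refine OperatorRelations.eq_of_forall_rep fun H _ _ _ T hT => ?_
      rw [map_star, OperatorRelations.rep_ugen]
      exact (hT.proj v).isSelfAdjoint.star_eq
  orthogonal v w hvw := by
    refine OperatorRelations.eq_of_forall_rep fun H _ _ _ T hT => ?_
    rw [map_mul, OperatorRelations.rep_ugen, OperatorRelations.rep_ugen, map_zero]
    exact hT.orthogonal v w hvw
  star_mul_self e := by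
    refine OperatorRelations.eq_of_forall_rep fun H _ _ _ T hT => ?_
    rw [map_mul, map_star, OperatorRelations.rep_ugen, OperatorRelations.rep_ugen]
    exact hT.star_mul_self e
  cuntz_krieger v hv := by
    refine OperatorRelations.eq_of_forall_rep fun H _ _ _ T hT => ?_
    rw [map_sum]
    simp only [map_mul, map_star, OperatorRelations.rep_ugen]
    exact hT.cuntz_krieger v hv

namespace IsCuntzKriegerFamily

variable {E : DirectedGraph} {hE : E.RowFinite} {A : Type*} [CStarAlgebra A]
  {P : E.Vert → A} {S : E.Edge → A} (h : IsCuntzKriegerFamily hE P S)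
include h

theorem isometry_mul_proj (e : E.Edge) : S e * P (E.range e) = S e := by
  have : star (S e * P (E.range e) - S e) * (S e * P (E.range e) - S e) = 0 := by
    have e1 : S e * P (E.range e) - S e = S e * (P (E.range e) - 1) := by rw [mul_sub, mul_one]
    rw [e1, star_mul, mul_assoc, ← mul_assoc (star (S e)), h.star_mul_self, mul_sub,
      (h.proj _).isIdempotentElem.eq, mul_one, sub_self, mul_zero]
  rwa [CStarRing.star_mul_self_eq_zero_iff, sub_eq_zero] at this

theorem proj_mul_star_isometry (e : E.Edge) : P (E.range e) * star (S e) = star (S e) := by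
  simpa [(h.proj _).isSelfAdjoint.star_eq] using congrArg star (h.isometry_mul_proj e)

theorem isStarProjection_mul_star (e : E.Edge) : IsStarProjection (S e * star (S e)) := by
  refine ⟨?_, IsSelfAdjoint.mul_star_self _⟩
  change S e * star (S e) * (S e * star (S e)) = _
  rw [mul_assoc, ← mul_assoc (star (S e)), h.star_mul_self, ← mul_assoc, h.isometry_mul_proj]

theorem mul_star_mul_isometry (e : E.Edge) : S e * star (S e) * S e = S e := by
  rw [mul_assoc, h.star_mul_self, h.isometry_mul_proj]

/-- `S_e S_e^*` is one of the positive summands of `P_{s(e)}`, hence a projection below it. -/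
theorem proj_mul_isometry (e : E.Edge) : P (E.source e) * S e = S e := by
  let := CStarAlgebra.spectralOrder A
  let := CStarAlgebra.spectralOrderedRing A
  have hle : S e * star (S e) ≤ P (E.source e) := by
    rw [h.cuntz_krieger _ ⟨e, rfl⟩]
    exact Finset.single_le_sum (f := fun e => S e * star (S e))
      (fun f _ => mul_star_self_nonneg (S f)) (hE.mem_out.2 rfl)
  have := ((h.isStarProjection_mul_star e).le_iff_mul_eq_right (h.proj _)).1 hle
  rw [← h.mul_star_mul_isometry e, ← mul_assoc, this]

/-- Projections whose sum is a projection are orthogonal: `S_e S_e^* ≤ P - S_f S_f^*`, and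
conjugation by `S_f` turns the right side into `0`. -/
theorem star_isometry_mul_isometry {e f : E.Edge} (hef : e ≠ f)
    (hs : E.source e = E.source f) : star (S e) * S f = 0 := by
  classical
  let := CStarAlgebra.spectralOrder A
  let := CStarAlgebra.spectralOrderedRing A
  have hf := h.isStarProjection_mul_star f
  have hle : S e * star (S e) ≤ P (E.source f) - S f * star (S f) := by
    rw [le_sub_iff_add_le, h.cuntz_krieger _ ⟨f, rfl⟩,
      ← Finset.sum_pair (f := fun e => S e * star (S e)) hef]
    refine Finset.sum_le_sum_of_subset_of_nonneg ?_ fun g _ _ => mul_star_self_nonneg (S g)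
    intro g hg
    rw [Finset.mem_insert, Finset.mem_singleton] at hg
    rcases hg with rfl | rfl
    · exact hE.mem_out.2 hs
    · exact hE.mem_out.2 rfl
  have h1 := star_left_conjugate_le_conjugate hle (S f)
  have h2 : star (S f) * (P (E.source f) - S f * star (S f)) * S f = 0 := by
    rw [mul_assoc, sub_mul, h.proj_mul_isometry, h.mul_star_mul_isometry, sub_self, mul_zero]
  have h3 : star (star (S e) * S f) * (star (S e) * S f) = 0 := by
    refine le_antisymm ?_ (star_mul_self_nonneg _)
    rw [h2] at h1
    simpa only [star_mul, star_star, mul_assoc] using h1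
  rwa [CStarRing.star_mul_self_eq_zero_iff] at h3

theorem isometry_mul_star_isometry {e f : E.Edge} (hr : E.range e ≠ E.range f) :
    S e * star (S f) = 0 := by
  rw [← h.isometry_mul_proj e, ← h.proj_mul_star_isometry f, mul_assoc, ← mul_assoc (P _),
    h.orthogonal _ _ hr, zero_mul, mul_zero]

end IsCuntzKriegerFamily

end DirectedGraph

namespace QuantumBall

open DirectedGraph

variable {A : Type*} [CStarAlgebra A] {n : ℕ}

/-- The phase `α_i` that belongs to the vertex `v_i`, `i ≠ 0`. -/
def vertexPhase (α : Fin n → A) : Fin (n + 1) → A := Fin.cases 0 α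

theorem vertexPhase_succ (α : Fin n → A) (i : Fin n) : vertexPhase α i.succ = α i := rfl

/-- The Cuntz-Krieger family of a system of phases. -/
theorem IsPhaseSystem.isCuntzKriegerFamily {Q : Fin (n + 1) → A} {α : Fin n → A}
    (h : IsPhaseSystem Q α) :
    IsCuntzKriegerFamily (ballGraph_rowFinite n) (fun v => vertexProj Q (vertexIndex v))
      (fun e => vertexPhase α (vertexIndex ((ballGraph n).source e)) *
        vertexProj Q (vertexIndex ((ballGraph n).range e))) where
  proj v := h.isStarProjection_vertexProj _
  orthogonal v w hvw := h.vertexProj_orthogonal fun e => hvw <| by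
    rw [← ballVertex_vertexIndex v, e, ballVertex_vertexIndex]
  star_mul_self e := by
    obtain ⟨i, j, hij, h1, h2⟩ := ballGraph_exists_index e
    have hj := h.isStarProjection_vertexProj j
    rw [h1, h2, vertexIndex_ballVertex, vertexIndex_ballVertex, vertexPhase_succ, star_mul,
      hj.isSelfAdjoint.star_eq, mul_assoc, ← mul_assoc (star (α i)), h.star_mul_self, ← mul_assoc,
      h.vertexProj_mul_of_le hij, hj.isIdempotentElem.eq]
  cuntz_krieger v hv := by
    obtain ⟨e, rfl⟩ := hv
    obtain ⟨i, -, -, h1, -⟩ := ballGraph_exists_index e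
    rw [h1]
    have e1 : ∀ e ∈ (ballGraph_rowFinite n).out (ballVertex n i.succ),
        vertexPhase α (vertexIndex ((ballGraph n).source e)) *
          vertexProj Q (vertexIndex ((ballGraph n).range e)) *
          star (vertexPhase α (vertexIndex ((ballGraph n).source e)) *
            vertexProj Q (vertexIndex ((ballGraph n).range e)))
        = α i * vertexProj Q (vertexIndex ((ballGraph n).range e)) * star (α i) := by
      intro e he
      have hj := h.isStarProjection_vertexProj (vertexIndex ((ballGraph n).range e))
      rw [(RowFinite.mem_out _).1 he, vertexIndex_ballVertex, vertexPhase_succ, star_mul,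
        hj.isSelfAdjoint.star_eq, mul_assoc, ← mul_assoc (vertexProj _ _),
        hj.isIdempotentElem.eq, ← mul_assoc]
    rw [Finset.sum_congr rfl e1,
      ballGraph_sum_out i (fun v => α i * vertexProj Q (vertexIndex v) * star (α i))]
    simp only [vertexIndex_ballVertex]
    -- The vertex projections up to `v_i` add up to `Q_i`, the initial projection of `α_i`.
    rw [← Finset.sum_mul, ← Finset.mul_sum, sum_vertexProj, (h.isCornerIsometry i).mul_right,
      h.self_mul_star, vertexProj_succ]

/-! ### From Cuntz-Krieger families to systems of phases. -/

section family

variable (P : (ballGraph n).Vert → A) (S : (ballGraph n).Edge → A)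

/-- The sum of the vertex projections, the unit of the graph algebra. -/
noncomputable def familyUnit : A := ∑ j, P (ballVertex n j)

/-- The sum of the partial isometries of the edges emitted by a vertex. -/
noncomputable def familySum (i : Fin n) : A :=
  ∑ e ∈ (ballGraph_rowFinite n).out (ballVertex n i.succ), S e

/-- `1 - p` at the last vertex, and zero elsewhere. -/
noncomputable def familyDefect (i : Fin (n + 1)) : A :=
  if i = Fin.last n then 1 - familyUnit P else 0

/-- The projections `Q_i` of a Cuntz-Krieger family, with unit adjoined at the last vertex. -/
noncomputable def familyQ (i : Fin (n + 1)) : A :=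
  ∑ j ∈ Finset.Iic i, P (ballVertex n j) + familyDefect P i

/-- The phases of a Cuntz-Krieger family, with unit adjoined at the last vertex. -/
noncomputable def familyPhase (i : Fin n) : A :=
  familySum S i + familyDefect P i.succ

variable {P S} (h : IsCuntzKriegerFamily (ballGraph_rowFinite n) P S)

theorem familyDefect_castSucc (i : Fin n) : familyDefect P i.castSucc = 0 :=
  if_neg i.castSucc_ne_last

include h

theorem familyUnit_mul_proj (v : (ballGraph n).Vert) : familyUnit P * P v = P v := by
  obtain ⟨j, rfl⟩ := (ballVertex_bijective n).2 v
  rw [familyUnit, Finset.sum_mul, Finset.sum_eq_single j]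
  · exact (h.proj _).isIdempotentElem.eq
  · exact fun i _ hij => h.orthogonal _ _ ((ballVertex_bijective n).1.ne hij)
  · exact fun hj => absurd (Finset.mem_univ j) hj

theorem star_familyUnit : star (familyUnit P) = familyUnit P := by
  rw [familyUnit, star_sum]
  exact Finset.sum_congr rfl fun j _ => (h.proj _).isSelfAdjoint.star_eq

theorem proj_mul_familyUnit (v : (ballGraph n).Vert) : P v * familyUnit P = P v := by
  simpa [(h.proj _).isSelfAdjoint.star_eq, star_familyUnit h] using
    congrArg star (familyUnit_mul_proj h v)

theorem isStarProjection_familyUnit : IsStarProjection (familyUnit P) := by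
  refine ⟨?_, star_familyUnit h⟩
  change familyUnit P * familyUnit P = _
  nth_rw 2 [familyUnit]
  rw [Finset.mul_sum]
  simp only [familyUnit_mul_proj h]
  rfl

theorem familyUnit_mul_isometry (e : (ballGraph n).Edge) : familyUnit P * S e = S e := by
  rw [← h.proj_mul_isometry, ← mul_assoc, familyUnit_mul_proj h]

theorem isometry_mul_familyUnit (e : (ballGraph n).Edge) : S e * familyUnit P = S e := by
  rw [← h.isometry_mul_proj, mul_assoc, proj_mul_familyUnit h]

theorem familyUnit_mul_familySum (i : Fin n) : familyUnit P * familySum S i = familySum S i := by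
  rw [familySum, Finset.mul_sum]
  exact Finset.sum_congr rfl fun e _ => familyUnit_mul_isometry h e

theorem familySum_mul_familyUnit (i : Fin n) : familySum S i * familyUnit P = familySum S i := by
  rw [familySum, Finset.sum_mul]
  exact Finset.sum_congr rfl fun e _ => isometry_mul_familyUnit h e

theorem isStarProjection_familyDefect (i : Fin (n + 1)) : IsStarProjection (familyDefect P i) := by
  unfold familyDefect
  split_ifs
  · exact (isStarProjection_familyUnit h).one_sub
  · exact .zero A

theorem familyDefect_mul_familyUnit (i : Fin (n + 1)) : familyDefect P i * familyUnit P = 0 := by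
  unfold familyDefect
  split_ifs
  · exact (isStarProjection_familyUnit h).one_sub_mul_self
  · exact zero_mul _

theorem familyUnit_mul_familyDefect (i : Fin (n + 1)) : familyUnit P * familyDefect P i = 0 := by
  unfold familyDefect
  split_ifs
  · exact (isStarProjection_familyUnit h).mul_one_sub_self
  · exact mul_zero _

theorem familyDefect_mul_of_eq {i : Fin (n + 1)} {a : A} (ha : familyUnit P * a = a) :
    familyDefect P i * a = 0 := by
  rw [← ha, ← mul_assoc, familyDefect_mul_familyUnit h, zero_mul]

theorem mul_familyDefect_of_eq {i : Fin (n + 1)} {a : A} (ha : a * familyUnit P = a) :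
    a * familyDefect P i = 0 := by
  rw [← ha, mul_assoc, familyUnit_mul_familyDefect h, mul_zero]

/-- The mixed terms `S_e^* S_f` vanish because the edges share their source. -/
theorem star_familySum_mul_self (i : Fin n) :
    star (familySum S i) * familySum S i = ∑ j ∈ Finset.Iic i.succ, P (ballVertex n j) := by
  rw [familySum, star_sum, Finset.sum_mul, ← ballGraph_sum_out i P]
  refine Finset.sum_congr rfl fun e he => ?_
  rw [Finset.mul_sum, Finset.sum_eq_single e, h.star_mul_self]
  · intro f hf hfe
    exact h.star_isometry_mul_isometry hfe.symm
      (((RowFinite.mem_out _).1 he).trans ((RowFinite.mem_out _).1 hf).symm)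
  · exact fun hh => absurd he hh

/-- The mixed terms `S_e S_f^*` vanish because distinct edges with the same source have distinct
ranges. -/
theorem familySum_mul_star_self (i : Fin n) :
    familySum S i * star (familySum S i) = P (ballVertex n i.succ) := by
  obtain ⟨e, he, -⟩ := ballGraph_exists_edge i 0 (Fin.zero_le _)
  rw [familySum, star_sum, Finset.sum_mul, h.cuntz_krieger _ ⟨e, he⟩]
  refine Finset.sum_congr rfl fun e he => ?_
  rw [Finset.mul_sum, Finset.sum_eq_single e]
  · intro f hf hfe
    refine h.isometry_mul_star_isometry fun hr => hfe (ballGraph_edge_ext ?_ hr.symm)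
    exact ((RowFinite.mem_out _).1 hf).trans ((RowFinite.mem_out _).1 he).symm
  · exact fun hh => absurd he hh

theorem familySum_mul_proj {i : Fin n} {e : (ballGraph n).Edge}
    (he : (ballGraph n).source e = ballVertex n i.succ) :
    familySum S i * P ((ballGraph n).range e) = S e := by
  rw [familySum, Finset.sum_mul, Finset.sum_eq_single e, h.isometry_mul_proj]
  · intro f hf hfe
    rw [← h.isometry_mul_proj f, mul_assoc, h.orthogonal, mul_zero]
    exact fun hr => hfe (ballGraph_edge_ext (((RowFinite.mem_out _).1 hf).trans he.symm) hr)
  · exact fun hh => absurd ((RowFinite.mem_out _).2 he) hh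

theorem sum_proj_mul_sum_proj {i j : Fin (n + 1)} (hij : i ≤ j) :
    (∑ k ∈ Finset.Iic i, P (ballVertex n k)) * ∑ k ∈ Finset.Iic j, P (ballVertex n k)
      = ∑ k ∈ Finset.Iic i, P (ballVertex n k) := by
  rw [Finset.sum_mul]
  refine Finset.sum_congr rfl fun k hk => ?_
  rw [Finset.mul_sum, Finset.sum_eq_single k]
  · exact (h.proj _).isIdempotentElem.eq
  · exact fun l _ hl => h.orthogonal _ _ ((ballVertex_bijective n).1.ne hl.symm)
  · exact fun hh => absurd (Finset.mem_Iic.2 ((Finset.mem_Iic.1 hk).trans hij)) hh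

theorem familyUnit_mul_sum_proj (i : Fin (n + 1)) :
    familyUnit P * ∑ k ∈ Finset.Iic i, P (ballVertex n k)
      = ∑ k ∈ Finset.Iic i, P (ballVertex n k) := by
  rw [Finset.mul_sum]
  exact Finset.sum_congr rfl fun k _ => familyUnit_mul_proj h _

theorem sum_proj_mul_familyUnit (i : Fin (n + 1)) :
    (∑ k ∈ Finset.Iic i, P (ballVertex n k)) * familyUnit P
      = ∑ k ∈ Finset.Iic i, P (ballVertex n k) := by
  rw [Finset.sum_mul]
  exact Finset.sum_congr rfl fun k _ => proj_mul_familyUnit h _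

theorem familyQ_mul_of_le {i j : Fin (n + 1)} (hij : i ≤ j) :
    familyQ P i * familyQ P j = familyQ P i := by
  -- The defect sits at the top index only, and `i` at the top forces `j = i`.
  have hd : familyDefect P i * familyDefect P j = familyDefect P i := by
    cases i using Fin.lastCases with
    | last =>
      rw [Fin.last_le_iff.1 hij]
      exact (isStarProjection_familyDefect h _).isIdempotentElem.eq
    | cast i => rw [familyDefect_castSucc, zero_mul]
  rw [familyQ, familyQ, add_mul, mul_add, mul_add, sum_proj_mul_sum_proj h hij,
    mul_familyDefect_of_eq h (sum_proj_mul_familyUnit h i),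
    familyDefect_mul_of_eq h (familyUnit_mul_sum_proj h j), hd, add_zero, zero_add]

/-- A Cuntz-Krieger family, with unit adjoined at the last vertex, is a system of phases. -/
theorem isPhaseSystem_family : IsPhaseSystem (familyQ P) (familyPhase P S) where
  proj i := by
    refine ⟨familyQ_mul_of_le h le_rfl, ?_⟩
    change star (familyQ P i) = familyQ P i
    rw [familyQ, star_add, star_sum, (isStarProjection_familyDefect h i).isSelfAdjoint.star_eq]
    congr 1
    exact Finset.sum_congr rfl fun k _ => (h.proj _).isSelfAdjoint.star_eq
  mul_of_le i j hij := familyQ_mul_of_le h hij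
  top := by
    have hI : Finset.Iic (Fin.last n) = Finset.univ := by
      ext j
      simp [Fin.le_last]
    rw [familyQ, hI, familyDefect, if_pos rfl, ← familyUnit, add_sub_cancel]
  star_mul_self i := by
    have hd := isStarProjection_familyDefect h i.succ
    have h1 : star (familySum S i) * familyDefect P i.succ = 0 := by
      refine mul_familyDefect_of_eq h ?_
      simpa [star_familyUnit h] using congrArg star (familyUnit_mul_familySum h i)
    rw [familyPhase, star_add, hd.isSelfAdjoint.star_eq, add_mul, mul_add, mul_add, h1,
      familyDefect_mul_of_eq h (familyUnit_mul_familySum h i), star_familySum_mul_self h,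
      hd.isIdempotentElem.eq, add_zero, zero_add, familyQ]
  self_mul_star i := by
    have hd := isStarProjection_familyDefect h i.succ
    have h1 : familyDefect P i.succ * star (familySum S i) = 0 := by
      refine familyDefect_mul_of_eq h ?_
      simpa [star_familyUnit h] using congrArg star (familySum_mul_familyUnit h i)
    rw [familyPhase, star_add, hd.isSelfAdjoint.star_eq, add_mul, mul_add, mul_add, h1,
      mul_familyDefect_of_eq h (familySum_mul_familyUnit h i), familySum_mul_star_self h,
      hd.isIdempotentElem.eq, add_zero, zero_add, familyQ, familyQ, sum_Iic_castSucc_add,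
      familyDefect_castSucc]
    abel

theorem vertexProj_family_mul_familyUnit (j : Fin (n + 1)) :
    vertexProj (familyQ P) j * familyUnit P = P (ballVertex n j) := by
  cases j using Fin.cases with
  | zero =>
    rw [vertexProj_zero, familyQ, add_mul, familyDefect_mul_familyUnit h, add_zero, sum_Iic_zero,
      proj_mul_familyUnit h]
  | succ j =>
    rw [vertexProj_succ, sub_mul, familyQ, familyQ, add_mul, add_mul,
      familyDefect_mul_familyUnit h, familyDefect_mul_familyUnit h, sum_proj_mul_familyUnit h,
      sum_proj_mul_familyUnit h, sum_Iic_castSucc_add]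
    abel

theorem familyPhase_mul_of_eq (i : Fin n) {a : A} (ha : familyUnit P * a = a) :
    familyPhase P S i * a = familySum S i * a := by
  rw [familyPhase, add_mul, familyDefect_mul_of_eq h ha, add_zero]

theorem familyPhase_mul_familyUnit (i : Fin n) :
    familyPhase P S i * familyUnit P = familySum S i := by
  rw [familyPhase_mul_of_eq h i (isStarProjection_familyUnit h).isIdempotentElem.eq,
    familySum_mul_familyUnit h]

theorem star_familyPhase_mul_familyUnit (i : Fin n) :
    star (familyPhase P S i) * familyUnit P = star (familySum S i) := by
  have h1 : familyUnit P * familyPhase P S i = familySum S i := by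
    rw [familyPhase, mul_add, familyUnit_mul_familyDefect h, add_zero, familyUnit_mul_familySum h]
  simpa [star_familyUnit h] using congrArg star h1

/-- The factor `p` must remain on the right for `k = 0`, where the power is `1`; in the series it is
absorbed by the neighbouring power of the phase. -/
theorem star_familyPhase_pow_mul_familyUnit (i : Fin n) (k : ℕ) :
    star (familyPhase P S i) ^ k * familyUnit P = familyUnit P * star (familySum S i) ^ k := by
  have h1 : familyUnit P * star (familySum S i) = star (familySum S i) := by
    simpa [star_familyUnit h] using congrArg star (familySum_mul_familyUnit h i)
  induction k with
  | zero => simp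
  | succ k ih =>
    rw [pow_succ, mul_assoc, star_familyPhase_mul_familyUnit h, ← h1, ← mul_assoc, ih, h1,
      mul_assoc, ← pow_succ]

theorem familyPhase_pow_mul_familyUnit (i : Fin n) (k : ℕ) :
    familyPhase P S i ^ (k + 1) * familyUnit P = familySum S i ^ (k + 1) := by
  induction k with
  | zero => simpa using familyPhase_mul_familyUnit h i
  | succ k ih =>
    rw [pow_succ, mul_assoc, familyPhase_mul_familyUnit h, ← familyUnit_mul_familySum h,
      ← mul_assoc, ih, ← pow_succ, familyUnit_mul_familySum h]

theorem familyPhase_series_mul_familyUnit (i : Fin n) (k : ℕ) :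
    familyPhase P S i ^ (k + 1) * star (familyPhase P S i) ^ k * familyUnit P
      = familySum S i ^ (k + 1) * star (familySum S i) ^ k := by
  rw [mul_assoc, star_familyPhase_pow_mul_familyUnit h, ← mul_assoc,
    familyPhase_pow_mul_familyUnit h]

end family

end QuantumBall

/-! ### The isomorphism -/

namespace QuantumBall

open OperatorRelations DirectedGraph

/-! ### Uniqueness of the projections and phases, and their existence in the universal algebra. -/

section unique

variable {A : Type*} [CStarAlgebra A] {n : ℕ} {q : ℝ} {x : Fin n → A}
  {Q Q' : Fin (n + 1) → A} {α α' : Fin n → A}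

/-- The `q`-relation is solved for the projection. It is available only for successor indices: `Q 0`
enters no such relation. -/
theorem IsBallSystem.proj_unique (hq1 : q < 1) (h : IsBallSystem q x Q α)
    (h' : IsBallSystem q x Q' α') (i : Fin n) : Q i.succ = Q' i.succ := by
  have hq : ((1 - q : ℝ) : ℂ) ≠ 0 := Complex.ofReal_ne_zero.2 (by linarith)
  have := (h.qrel i).symm.trans (h'.qrel i)
  rw [← sub_eq_zero, ← smul_sub] at this
  exact sub_eq_zero.1 ((smul_eq_zero.1 this).resolve_left hq)

theorem IsBallSystem.phase_unique (hq1 : q < 1) (h : IsBallSystem q x Q α)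
    (h' : IsBallSystem q x Q' α') (i : Fin n) : α i = α' i := by
  have h1 := h.phase i
  rw [h.proj_unique hq1 h' i] at h1
  exact h1.unique (h'.phase i)

end unique

/-- The elements `x_1, …, x_n` of `C^*(x_1, …, x_n)` satisfy the relations of the quantum ball. -/
theorem exists_isBallSystem_xgen (n : ℕ) (q : ℝ) (hq0 : 0 < q) (hq1 : q < 1) :
    ∃ (Q : Fin (n + 1) → PolyCStar n q hq0 hq1) (α : Fin n → PolyCStar n q hq0 hq1),
      IsBallSystem q (xgen hq0 hq1) Q α := by
  let x : Fin n → PolyCStar n q hq0 hq1 := xgen hq0 hq1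
  have hx : ∀ {H : Type} [NormedAddCommGroup H] [InnerProductSpace ℂ H] [CompleteSpace H]
      {T : Fin n → H →L[ℂ] H} (hT : (ballRelations n q hq0 hq1).Holds H T) (i : Fin n),
      rep hT (x i) = T i := fun hT i => rep_ugen hT i
  have hq : ((1 - q : ℝ) : ℂ) ≠ 0 := Complex.ofReal_ne_zero.2 (by linarith)
  -- The `q`-relation, solved for `Q_i`, expresses this projection as a polynomial in `x_i`, so it
  -- exists in the universal algebra and its properties can be tested in representations.
  let R : Fin n → PolyCStar n q hq0 hq1 := fun i =>
    ((1 - q : ℝ) : ℂ)⁻¹ • (star (x i) * x i - (q : ℂ) • (x i * star (x i)))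
  have hR : ∀ i, star (x i) * x i - (q : ℂ) • (x i * star (x i))
      = ((1 - q : ℝ) : ℂ) • R i := fun i => (smul_inv_smul₀ hq _).symm
  have hrepR : ∀ {H : Type} [NormedAddCommGroup H] [InnerProductSpace ℂ H] [CompleteSpace H]
      {T : Fin n → H →L[ℂ] H} (hT : (ballRelations n q hq0 hq1).Holds H T)
      {Q : Fin (n + 1) → H →L[ℂ] H} {α : Fin n → H →L[ℂ] H} (_ : IsBallSystem q T Q α)
      (i : Fin n), rep hT (R i) = Q i.succ := by
    intro H _ _ _ T hT Q α h i
    simp only [R, map_smul, map_sub, map_mul, map_star, hx]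
    rw [h.qrel, inv_smul_smul₀ hq]
  have hproj : ∀ i, IsStarProjection (R i) := by
    intro i
    constructor
    · refine eq_of_forall_rep fun H _ _ _ T hT => ?_
      obtain ⟨Q, α, h⟩ := id hT
      rw [map_mul, hrepR hT h]
      exact (h.isStarProjection _).isIdempotentElem.eq
    · refine eq_of_forall_rep fun H _ _ _ T hT => ?_
      obtain ⟨Q, α, h⟩ := id hT
      rw [map_star, hrepR hT h]
      exact (h.isStarProjection _).isSelfAdjoint.star_eq
  have hcorner : ∀ i, R i * x i * R i = x i := by
    intro i
    refine eq_of_forall_rep fun H _ _ _ T hT => ?_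
    obtain ⟨Q, α, h⟩ := id hT
    rw [map_mul, map_mul, hrepR hT h, hx]
    exact (h.phase i).2.1
  choose α hα using fun i => exists_isCornerPhase hq0 hq1 (hproj i) (hcorner i) (hR i)
  have hrepα : ∀ {H : Type} [NormedAddCommGroup H] [InnerProductSpace ℂ H] [CompleteSpace H]
      {T : Fin n → H →L[ℂ] H} (hT : (ballRelations n q hq0 hq1).Holds H T)
      {Q : Fin (n + 1) → H →L[ℂ] H} {β : Fin n → H →L[ℂ] H} (_ : IsBallSystem q T Q β)
      (i : Fin n), rep hT (α i) = β i := by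
    intro H _ _ _ T hT Q β h i
    have h1 := (hα i).map (rep hT)
    rw [hrepR hT h, hx] at h1
    exact h1.unique (h.phase i)
  have hmul : ∀ i j, i < j → x i * x j = 0 := by
    intro i j hij
    refine eq_of_forall_rep fun H _ _ _ T hT => ?_
    obtain ⟨Q, α, h⟩ := id hT
    rw [map_mul, hx, hx, map_zero]
    exact h.mul_eq_zero i j hij
  have hstar : ∀ i j, i ≠ j → star (x i) * x j = 0 := by
    intro i j hij
    refine eq_of_forall_rep fun H _ _ _ T hT => ?_
    obtain ⟨Q, α, h⟩ := id hT
    rw [map_mul, map_star, hx, hx, map_zero]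
    exact h.star_mul_eq_zero i j hij
  rcases n with _ | m
  · exact ⟨fun _ => 1, α, hmul, hstar, rfl, fun i => i.elim0, fun i => i.elim0, fun i => i.elim0⟩
  -- The lowest projection has no polynomial of its own and is defined by the recursion.
  · refine ⟨Fin.cases (motive := fun _ => PolyCStar (m + 1) q hq0 hq1)
      (R 0 - α 0 * star (α 0)) R, α,
      hmul, hstar, ?_, hα, ?_, hR⟩
    · change R (Fin.last m) = 1
      refine eq_of_forall_rep fun H _ _ _ T hT => ?_
      obtain ⟨Q, α, h⟩ := id hT
      rw [hrepR hT h, map_one]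
      exact h.top
    · intro i
      cases i using Fin.cases with
      | zero => rfl
      | succ i =>
        change R i.castSucc = R i.succ - α i.succ * star (α i.succ)
        refine eq_of_forall_rep fun H _ _ _ T hT => ?_
        obtain ⟨Q, β, h⟩ := id hT
        rw [map_sub, map_mul, map_star, hrepR hT h, hrepR hT h, hrepα hT h]
        exact h.step i.succ

/-! ### Cutting the series down by the unit `p` of the graph algebra. -/

section family

variable {A : Type*} [CStarAlgebra A] {n : ℕ} {P : (ballGraph n).Vert → A}
  {S : (ballGraph n).Edge → A} (h : IsCuntzKriegerFamily (ballGraph_rowFinite n) P S)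
include h

theorem commute_familyUnit_familyPhase (i : Fin n) :
    Commute (familyUnit P) (familyPhase P S i) := by
  have h1 := congrArg star (star_familyPhase_mul_familyUnit h i)
  rw [star_mul, star_star, star_star, star_familyUnit h] at h1
  exact h1.trans (familyPhase_mul_familyUnit h i).symm

theorem commute_familyUnit_series {q : ℝ} (hq0 : 0 < q) (hq1 : q < 1) (i : Fin n) :
    Commute (familyUnit P)
      (familyPhase P S i * modulusSeries q (familyQ P i.succ) (familyPhase P S i)) := by
  have h1 := ((isPhaseSystem_family h).isCornerIsometry i).hasSum_mul_modulusSeries hq0 hq1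
  have h2 := commute_familyUnit_familyPhase h i
  have h3 : Commute (familyUnit P) (star (familyPhase P S i)) := by
    have := h2.star_star
    rwa [star_familyUnit h] at this
  refine (h1.mul_left (familyUnit P)).unique ?_
  have h4 := h1.mul_right (familyUnit P)
  have e : (fun k => (coeff q k : ℂ) • (familyPhase P S i ^ (k + 1) *
      star (familyPhase P S i) ^ k) * familyUnit P) = fun k => familyUnit P * ((coeff q k : ℂ) •
        (familyPhase P S i ^ (k + 1) * star (familyPhase P S i) ^ k)) := by
    funext k
    exact (((h2.pow_right (k + 1)).mul_right (h3.pow_right k)).smul_right (coeff q k : ℂ)).eq.symm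
  rwa [e] at h4

/-- The defect in the phase is orthogonal to `p`, so only the series in `S_i` remains: the element
`z_i`. -/
theorem hasSum_series_mul_familyUnit {q : ℝ} (hq0 : 0 < q) (hq1 : q < 1) (i : Fin n) :
    HasSum (fun k => (coeff q k : ℂ) • (familySum S i ^ (k + 1) * star (familySum S i) ^ k))
      (familyPhase P S i * modulusSeries q (familyQ P i.succ) (familyPhase P S i) *
        familyUnit P) := by
  have h1 := ((isPhaseSystem_family h).isCornerIsometry i).hasSum_mul_modulusSeries hq0 hq1
  have h2 := h1.mul_right (familyUnit P)
  simpa only [smul_mul_assoc, familyPhase_series_mul_familyUnit h] using h2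

end family

section iso

variable {n : ℕ} {q : ℝ} (hq0 : 0 < q) (hq1 : q < 1)

/-- The unital `C^*`-algebra that contains the graph algebra. -/
abbrev GraphUniversal (n : ℕ) : Type := (cuntzKrieger (ballGraph_rowFinite n)).UniversalCStar

/-- The universal vertex projections. -/
noncomputable def univP (v : (ballGraph n).Vert) : GraphUniversal n :=
  (cuntzKrieger (ballGraph_rowFinite n)).ugen (Sum.inl v)

/-- The universal partial isometries. -/
noncomputable def univS (e : (ballGraph n).Edge) : GraphUniversal n :=
  (cuntzKrieger (ballGraph_rowFinite n)).ugen (Sum.inr e)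

theorem isCuntzKriegerFamily_univ :
    IsCuntzKriegerFamily (ballGraph_rowFinite n) (univP (n := n)) univS :=
  isCuntzKriegerFamily_ugen _

theorem univP_mem (v : (ballGraph n).Vert) : univP v ∈ ballCStar n := ugen_mem _ _

theorem univS_mem (e : (ballGraph n).Edge) : univS e ∈ ballCStar n := ugen_mem _ _

theorem isClosed_ballCStar : IsClosed (ballCStar n : Set (GraphUniversal n)) :=
  NonUnitalStarSubalgebra.isClosed_topologicalClosure _

theorem coe_ballSum (i : Fin n) : (ballSum i : GraphUniversal n) = familySum univS i := by
  rw [ballSum, familySum, AddSubmonoidClass.coe_finsetSum]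
  rfl

theorem familyUnit_univ_mem : familyUnit (univP (n := n)) ∈ ballCStar n :=
  sum_mem fun _ _ => univP_mem _

/-- The induction wraps `S_i · S_i^*` around the previous word, since the power of `S_i^*` alone is
`1` at `k = 0` and need not lie in the subalgebra. -/
theorem familySum_series_mem (i : Fin n) (k : ℕ) :
    familySum univS i ^ (k + 1) * star (familySum univS i) ^ k ∈ ballCStar n := by
  have hS : familySum univS i ∈ ballCStar n := sum_mem fun _ _ => univS_mem _
  induction k with
  | zero => simpa using hS
  | succ k ih =>
    rw [pow_succ' (familySum univS i) (k + 1), pow_succ (star (familySum univS i)), mul_assoc,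
      ← mul_assoc (_ ^ (k + 1)), ← mul_assoc]
    exact mul_mem (mul_mem hS ih) (star_mem hS)

theorem exists_ball_to_graph : ∃ ψ : PolyCStar n q hq0 hq1 →⋆ₐ[ℂ] GraphUniversal n,
    ∀ i, ψ (xgen hq0 hq1 i) = familyPhase univP univS i *
      modulusSeries q (familyQ univP i.succ) (familyPhase univP univS i) :=
  exists_universal_hom _ fun _ _ _ _ _ hT =>
    ⟨_, _, ((isPhaseSystem_family isCuntzKriegerFamily_univ).isBallSystem hq0 hq1).map (rep hT)⟩

theorem exists_graph_to_ball {Q : Fin (n + 1) → PolyCStar n q hq0 hq1}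
    {α : Fin n → PolyCStar n q hq0 hq1} (h : IsPhaseSystem Q α) :
    ∃ φ : GraphUniversal n →⋆ₐ[ℂ] PolyCStar n q hq0 hq1,
      (∀ v, φ (univP v) = vertexProj Q (vertexIndex v)) ∧
      ∀ e, φ (univS e) = vertexPhase α (vertexIndex ((ballGraph n).source e)) *
        vertexProj Q (vertexIndex ((ballGraph n).range e)) := by
  obtain ⟨φ, hφ⟩ := exists_universal_hom (R := cuntzKrieger (ballGraph_rowFinite n))
    (R' := ballRelations n q hq0 hq1)
    (Sum.elim (fun v => vertexProj Q (vertexIndex v))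
      (fun e => vertexPhase α (vertexIndex ((ballGraph n).source e)) *
        vertexProj Q (vertexIndex ((ballGraph n).range e))))
    fun _ _ _ _ _ hT => h.isCuntzKriegerFamily.map (rep hT)
  exact ⟨φ, fun v => hφ (Sum.inl v), fun e => hφ (Sum.inr e)⟩

/-! ### The two homomorphisms and their compositions. -/

section toGraph

variable {hq0 hq1} {ψ : PolyCStar n q hq0 hq1 →⋆ₐ[ℂ] GraphUniversal n}
  (hψ : ∀ i, ψ (xgen hq0 hq1 i) = familyPhase univP univS i *
      modulusSeries q (familyQ univP i.succ) (familyPhase univP univS i))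
include hψ

/-- The self-adjoint `p` commutes with the images of the generators, hence with their adjoints and
with limits of polynomials in them. This makes `a ↦ ψ(a) p` a `*`-homomorphism. -/
theorem commute_familyUnit_univ (a : PolyCStar n q hq0 hq1) :
    Commute (familyUnit univP) (ψ a) := by
  have hc := starAlgHom_continuous ψ
  have hgen (i : Fin n) : Commute (familyUnit univP) (ψ (xgen hq0 hq1 i)) := by
    rw [hψ]
    exact commute_familyUnit_series isCuntzKriegerFamily_univ hq0 hq1 i
  refine generator_induction (C := fun a => Commute (familyUnit univP) (ψ a))
    (isClosed_eq (by fun_prop) (by fun_prop))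
    (fun c => ?_) hgen (fun i => ?_)
    (fun a b ha hb => ?_) (fun a b ha hb => ?_) a
  · rw [AlgHomClass.commutes]
    exact Algebra.commute_algebraMap_right c _
  · rw [map_star]
    have := (hgen i).star_star
    rwa [star_familyUnit isCuntzKriegerFamily_univ] at this
  · rw [map_mul]
    exact ha.mul_right hb
  · rw [map_add]
    exact ha.add_right hb

theorem map_mul_familyUnit (a b : PolyCStar n q hq0 hq1) :
    ψ (a * b) * familyUnit univP = ψ a * familyUnit univP * (ψ b * familyUnit univP) := by
  rw [mul_assoc, ← mul_assoc (familyUnit univP), (commute_familyUnit_univ hψ b).eq, mul_assoc,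
    (isStarProjection_familyUnit isCuntzKriegerFamily_univ).isIdempotentElem.eq, map_mul,
    mul_assoc]

theorem map_star_familyUnit (a : PolyCStar n q hq0 hq1) :
    ψ (star a) * familyUnit univP = star (ψ a * familyUnit univP) := by
  rw [star_mul, star_familyUnit isCuntzKriegerFamily_univ, ← map_star,
    (commute_familyUnit_univ hψ _).eq]

theorem mul_familyUnit_mem (a : PolyCStar n q hq0 hq1) :
    ψ a * familyUnit univP ∈ ballCStar n := by
  have hc := starAlgHom_continuous ψ
  have hgen (i : Fin n) : ψ (xgen hq0 hq1 i) * familyUnit univP ∈ ballCStar n := by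
    rw [hψ]
    have h1 := (hasSum_series_mul_familyUnit isCuntzKriegerFamily_univ hq0 hq1 i).tendsto_sum_nat
    refine isClosed_ballCStar.mem_of_tendsto h1 (Filter.Eventually.of_forall fun N => ?_)
    exact sum_mem fun k _ => SMulMemClass.smul_mem _ (familySum_series_mem i k)
  refine generator_induction (C := fun a => ψ a * familyUnit univP ∈ ballCStar n)
    (isClosed_ballCStar.preimage (f := fun a => ψ a * familyUnit univP) (by fun_prop))
    (fun c => ?_) hgen (fun i => ?_)
    (fun a b ha hb => ?_) (fun a b ha hb => ?_) a
  -- Scalars become multiples of `p`, which lies in the graph algebra although `1` need not.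
  · rw [AlgHomClass.commutes, ← Algebra.smul_def]
    exact SMulMemClass.smul_mem _ familyUnit_univ_mem
  · have := star_mem (hgen i)
    rwa [← map_star_familyUnit hψ] at this
  · rw [map_mul_familyUnit hψ]
    exact mul_mem ha hb
  · rw [map_add, add_mul]
    exact add_mem ha hb

variable {Q : Fin (n + 1) → PolyCStar n q hq0 hq1} {α : Fin n → PolyCStar n q hq0 hq1}
  (h : IsBallSystem q (xgen hq0 hq1) Q α)
include h

/-- The image under `ψ` of the system of the `x_i` and the system built from the Cuntz-Krieger
phases have the same generators, so uniqueness applies. -/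
theorem map_ball_system :
    (∀ i : Fin n, ψ (Q i.succ) = familyQ univP i.succ) ∧
      ∀ i, ψ (α i) = familyPhase univP univS i := by
  have h1 := h.map ψ
  simp only [hψ] at h1
  have h2 := (isPhaseSystem_family (isCuntzKriegerFamily_univ (n := n))).isBallSystem hq0 hq1
  exact ⟨h1.proj_unique hq1 h2, h1.phase_unique hq1 h2⟩

theorem map_proj_mul_familyUnit (i : Fin (n + 1)) :
    ψ (Q i) * familyUnit univP = familyQ univP i * familyUnit univP := by
  obtain ⟨h1, h2⟩ := map_ball_system hψ h
  have hphase := isPhaseSystem_family (isCuntzKriegerFamily_univ (n := n))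
  cases i using Fin.lastCases with
  | last => rw [h.top, map_one, hphase.top]
  | cast i =>
    rw [h.step, map_sub, map_mul, map_star, h1, h2, hphase.self_mul_star, sub_sub_cancel]

theorem map_vertexProj_mul_familyUnit (j : Fin (n + 1)) :
    ψ (vertexProj Q j) * familyUnit univP = univP (ballVertex n j) := by
  rw [← vertexProj_family_mul_familyUnit (isCuntzKriegerFamily_univ (n := n))]
  cases j using Fin.cases with
  | zero => exact map_proj_mul_familyUnit hψ h 0
  | succ j =>
    rw [vertexProj_succ, vertexProj_succ, map_sub, sub_mul, sub_mul,
      map_proj_mul_familyUnit hψ h, map_proj_mul_familyUnit hψ h]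

variable {φ : GraphUniversal n →⋆ₐ[ℂ] PolyCStar n q hq0 hq1}
  (hφP : ∀ v, φ (univP v) = vertexProj Q (vertexIndex v))
  (hφS : ∀ e, φ (univS e) = vertexPhase α (vertexIndex ((ballGraph n).source e)) *
        vertexProj Q (vertexIndex ((ballGraph n).range e)))
include hφP hφS

/-- The elements with this property form a closed `*`-subalgebra, so the generators suffice. The
subalgebra is only non-unital, because `1` is sent to `p`. -/
theorem right_inverse_of_mem {b : GraphUniversal n} (hb : b ∈ ballCStar n) :
    ψ (φ b) * familyUnit univP = b := by
  let t : NonUnitalStarSubalgebra ℂ (GraphUniversal n) :=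
    { carrier := {b | ψ (φ b) * familyUnit univP = b}
      add_mem' := fun {a b} ha hb => by
        simp only [Set.mem_ofPred_eq] at ha hb ⊢
        rw [map_add, map_add, add_mul, ha, hb]
      zero_mem' := by simp
      mul_mem' := fun {a b} ha hb => by
        simp only [Set.mem_ofPred_eq] at ha hb ⊢
        rw [map_mul, map_mul_familyUnit hψ, ha, hb]
      smul_mem' := fun c a ha => by
        simp only [Set.mem_ofPred_eq] at ha ⊢
        rw [map_smul, map_smul, smul_mul_assoc, ha]
      star_mem' := fun {a} ha => by
        simp only [Set.mem_ofPred_eq] at ha ⊢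
        rw [map_star, map_star_familyUnit hψ, ha] }
  have hclosed : IsClosed (t : Set (GraphUniversal n)) :=
    isClosed_eq (((starAlgHom_continuous ψ).comp (starAlgHom_continuous φ)).mul continuous_const)
      continuous_id
  refine NonUnitalStarSubalgebra.topologicalClosure_minimal _ ?_ hclosed hb
  refine NonUnitalStarAlgebra.adjoin_le ?_
  rintro _ ⟨v | e, rfl⟩
  · change ψ (φ (univP v)) * familyUnit univP = univP v
    rw [hφP, map_vertexProj_mul_familyUnit hψ h, ballVertex_vertexIndex]
  · change ψ (φ (univS e)) * familyUnit univP = univS e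
    obtain ⟨i, j, -, h1, h2⟩ := ballGraph_exists_index e
    rw [hφS, h1, vertexIndex_ballVertex, vertexPhase_succ, map_mul, mul_assoc,
      map_vertexProj_mul_familyUnit hψ h, ballVertex_vertexIndex, (map_ball_system hψ h).2,
      familyPhase_mul_of_eq isCuntzKriegerFamily_univ _
        (familyUnit_mul_proj isCuntzKriegerFamily_univ _),
      familySum_mul_proj isCuntzKriegerFamily_univ h1]

omit hψ hφP in
theorem map_familySum (i : Fin n) : φ (familySum univS i) = α i := by
  have hp := h.isPhaseSystem
  have e1 : ∀ e ∈ (ballGraph_rowFinite n).out (ballVertex n i.succ),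
      φ (univS e) = α i * vertexProj Q (vertexIndex ((ballGraph n).range e)) := by
    intro e he
    rw [hφS, (RowFinite.mem_out _).1 he, vertexIndex_ballVertex, vertexPhase_succ]
  rw [familySum, map_sum, Finset.sum_congr rfl e1,
    ballGraph_sum_out i (fun v => α i * vertexProj Q (vertexIndex v))]
  simp only [vertexIndex_ballVertex]
  rw [← Finset.mul_sum, sum_vertexProj, (hp.isCornerIsometry i).mul_right]

omit hψ hφS h in
theorem map_sum_proj (i : Fin (n + 1)) :
    φ (∑ j ∈ Finset.Iic i, univP (ballVertex n j)) = Q i := by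
  rw [map_sum]
  simp only [hφP, vertexIndex_ballVertex]
  exact sum_vertexProj Q i

omit hψ hφS in
theorem map_familyUnit : φ (familyUnit univP) = 1 := by
  have hI : Finset.Iic (Fin.last n) = Finset.univ := by
    ext j
    simp [Fin.le_last]
  rw [familyUnit, ← hI, map_sum_proj hφP, h.top]

omit hψ hφS in
-- In the ball algebra the vertex projections add up to `Q_n = 1`, so the adjoined part `1 - p`
-- disappears.
theorem map_familyDefect (i : Fin (n + 1)) : φ (familyDefect univP i) = 0 := by
  unfold familyDefect
  split_ifs
  · rw [map_sub, map_one, map_familyUnit h hφP, sub_self]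
  · exact map_zero φ

/-- The elements `φ(ψ(x_i))` form a ball system with the same `Q` and `α` as the `x_i`, and by
`IsCornerPhase.eq_series` such elements are given by one and the same series. -/
theorem left_inverse (a : PolyCStar n q hq0 hq1) : φ (ψ a) = a := by
  refine universal_hom_ext (R := ballRelations n q hq0 hq1) (F := φ.comp ψ)
    (G := StarAlgHom.id ℂ _) (fun i => ?_) a
  have h1 := ((isPhaseSystem_family (isCuntzKriegerFamily_univ (n := n))).isBallSystem
    hq0 hq1).map φ
  have hQ : ∀ i, φ (familyQ univP i) = Q i := fun i => by
    rw [familyQ, map_add, map_sum_proj hφP, map_familyDefect h hφP, add_zero]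
  have hα : ∀ i, φ (familyPhase univP univS i) = α i := fun i => by
    rw [familyPhase, map_add, map_familySum h hφS, map_familyDefect h hφP, add_zero]
  simp only [hQ, hα, ← hψ] at h1
  change φ (ψ (xgen hq0 hq1 i)) = xgen hq0 hq1 i
  rw [(h1.phase i).eq_series hq0 hq1 (h1.qrel i)]
  exact ((h.phase i).eq_series hq0 hq1 (h.qrel i)).symm

end toGraph

end iso

end QuantumBall

open QuantumBall in
theorem mainTheorem1 (n : ℕ) (q : ℝ) (hq0 : 0 < q) (hq1 : q < 1) :
    ∃ Φ : PolyCStar n q hq0 hq1 ≃⋆ₐ[ℂ] ballCStar n,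
      -- the isomorphism sends `x_i` to `z_i`; the powers are taken in the unital algebra in which
      -- `C^*(E_n)` is contained, the series converges in norm
      (∀ i : Fin n, HasSum
        (fun k : ℕ => (coeff q k : ℂ) •
          (((ballSum i : ballCStar n) :
              (DirectedGraph.cuntzKrieger (ballGraph_rowFinite n)).UniversalCStar) ^ (k + 1) *
            star ((ballSum i : ballCStar n) :
              (DirectedGraph.cuntzKrieger (ballGraph_rowFinite n)).UniversalCStar) ^ k))
        ((Φ (xgen hq0 hq1 i) : ballCStar n) :
          (DirectedGraph.cuntzKrieger (ballGraph_rowFinite n)).UniversalCStar)) ∧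
      -- the inverse is given by the phases `α_i` of the `x_i`
      ∃ (Q : Fin (n + 1) → PolyCStar n q hq0 hq1) (α : Fin n → PolyCStar n q hq0 hq1),
        IsBallSystem q (xgen hq0 hq1) Q α ∧
        (∀ i : Fin n, Φ.symm (ballSum i) = α i) ∧
        (∀ j : Fin n, Φ.symm (ballP j.succ) = α j * star (α j)) ∧
        (∀ k : Fin n, k.val = 0 →
          Φ.symm (ballP 0) = star (α k) * α k - α k * star (α k)) ∧
        (∀ (i j : Fin n) (e : (ballGraph n).Edge),
          (ballGraph n).source e = ballVertex n i.succ →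
          (ballGraph n).range e = ballVertex n j.succ →
          Φ.symm (ballS e) = α i * (α j * star (α j))) ∧
        (∀ (i k : Fin n) (e : (ballGraph n).Edge), k.val = 0 →
          (ballGraph n).source e = ballVertex n i.succ →
          (ballGraph n).range e = ballVertex n 0 →
          Φ.symm (ballS e) = α i * (star (α k) * α k - α k * star (α k))) := by
  obtain ⟨Q, α, h⟩ := exists_isBallSystem_xgen n q hq0 hq1
  obtain ⟨ψ, hψ⟩ := exists_ball_to_graph (n := n) hq0 hq1
  obtain ⟨φ, hφP, hφS⟩ := exists_graph_to_ball hq0 hq1 h.isPhaseSystem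
  have hp := h.isPhaseSystem
  -- Multiplication by `p`, the unit of the graph algebra, moves the unital image of `ψ` into that
  -- subalgebra.
  let Φ : PolyCStar n q hq0 hq1 ≃⋆ₐ[ℂ] ballCStar n :=
    { toFun := fun a => ⟨ψ a * familyUnit univP, mul_familyUnit_mem hψ a⟩
      invFun := fun b => φ b
      left_inv := fun a => by
        change φ (ψ a * familyUnit univP) = a
        rw [map_mul, left_inverse hψ h hφP hφS, map_familyUnit h hφP, mul_one]
      right_inv := fun b => Subtype.ext (right_inverse_of_mem hψ h hφP hφS b.2)
      map_mul' := fun a b => Subtype.ext (map_mul_familyUnit hψ a b)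
      map_add' := fun a b => Subtype.ext (by
        change ψ (a + b) * familyUnit univP = ψ a * familyUnit univP + ψ b * familyUnit univP
        rw [map_add, add_mul])
      map_star' := fun a => Subtype.ext (map_star_familyUnit hψ a)
      map_smul' := fun c a => Subtype.ext (by
        change ψ (c • a) * familyUnit univP = c • (ψ a * familyUnit univP)
        rw [map_smul, smul_mul_assoc]) }
  have hsymm : ∀ b, Φ.symm b = φ b := fun _ => rfl
  have hP : ∀ j, Φ.symm (ballP j) = vertexProj Q j := fun j =>
    (hφP (ballVertex n j)).trans (by rw [vertexIndex_ballVertex])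
  have hS : ∀ (i : Fin n) (j : Fin (n + 1)) (e : (ballGraph n).Edge),
      (ballGraph n).source e = ballVertex n i.succ → (ballGraph n).range e = ballVertex n j →
      Φ.symm (ballS e) = α i * vertexProj Q j := fun i j e h1 h2 =>
    (hφS e).trans (by rw [h1, h2, vertexIndex_ballVertex, vertexIndex_ballVertex,
      vertexPhase_succ])
  -- `P_0` corresponds to `Q_0 = Q_1 - α_1 α_1^*`, where `Q_1 = α_1^* α_1`; the index `k = 0` stands
  -- for `α_1`.
  have h0 : ∀ k : Fin n, k.val = 0 →
      vertexProj Q 0 = star (α k) * α k - α k * star (α k) := by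
    intro k hk
    have hk0 : k.castSucc = 0 := Fin.ext hk
    rw [vertexProj_zero, hp.star_mul_self, ← h.step, hk0]
  refine ⟨Φ, fun i => ?_, Q, α, h, fun i => ?_, fun j => ?_, fun k hk => ?_,
    fun i j e h1 h2 => ?_, fun i k e hk h1 h2 => ?_⟩
  · have h1 := hasSum_series_mul_familyUnit (isCuntzKriegerFamily_univ (n := n)) hq0 hq1 i
    rw [← hψ] at h1
    rw [coe_ballSum]
    exact h1
  · rw [hsymm, coe_ballSum, map_familySum h hφS]
  · rw [hP, vertexProj_succ, hp.self_mul_star]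
  · rw [hP, h0 k hk]
  · rw [hS i _ e h1 h2, vertexProj_succ, hp.self_mul_star]
  · rw [hS i 0 e h1 h2, h0 k hk]
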